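/- Let $\mathfrak F$ be the class of differentiable functions $\Psi:\mathbb R\to[0,1]$ such that $\Psi'\le 0$, $\Psi'$ is Riemann integrable (on every bounded interval), $\Psi\in L^1(0,\infty)$ and $1-\Psi\in L^1(-\infty,0)$. Put $\Phi=-\Psi'$ and let $\mathfrak F'$ be the set of $\Psi\in\mathfrak F$ for which there is $c>0$ with $\Phi(x)\le e^{-c|x|}$ for all $x\in\mathbb R$. Let $h_n(x)=e^{x^2/2}\frac{(-1)^n}{\sqrt{n!\,2^n\sqrt\pi}}\frac{d^n}{dx^n}e^{-x^2}$ be the Hermite functions, and for real $N>0$ let $\varphi_k(x)=\sqrt{\frac{\pi\sqrt N}{\sqrt2}}\;h_k\!\left(x\frac{\pi\sqrt N}{\sqrt2}\right)$. For $\tau>0$ and $\alpha\in(0,1)$ the kernel of the modified GUE is $$K^N_{\Psi,\alpha}(x,y)=\sum_{k=0}^\infty \Psi\!\left(\frac{k-N}{\tau N^\alpha}\right)\varphi_k(x)\varphi_k(y).$$ For $k\in\mathbb Z$ let $\xi_k=\xi_k(N)\in(0,1)$ be any number (it exists by the mean value theorem) with $\frac1{\tau N^\alpha}\Phi\!\left(\frac{k+\xi_k}{\tau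 N^\alpha}\right)=\Psi\!\left(\frac{k}{\tau N^\alpha}\right)-\Psi\!\left(\frac{k+1}{\tau N^\alpha}\right)$, and let $$L^N_{\Psi,\eta}(x,y)=\frac1{\tau N^\alpha}\sum_{k\in\mathbb Z,\ |k|\le\Gamma N^\alpha}\Phi\!\left(\frac{k+\xi_k}{\tau N^\alpha}\right)\frac{\sin[2\pi\eta(k)(x-y)]}{\pi(x-y)},\qquad \Gamma=(\log N)^2,\quad \eta(k)=\tfrac12N^{1-\alpha}\sqrt{1+k/N},$$ where the quotient is read as $2\eta(k)$ when $x=y$ (and $\sqrt{1+k/N}$ as $0$ when $k<-N$, which does not occur for large $N$). For a kernel $K$ on $\mathbb R$, a continuous compactly supported $f:\mathbb R\to\mathbb R$ and $n\ge1$, the $n$-th cumulant is $$C^n_K[\Xi f]=\sum_{\ell=1}^n\frac{(-1)^{\ell+1}}{\ell}\sum_{\substack{m_1,\dots,m_\ell\ge1\\ m_1+\dots+m_\ell=n}}\frac{n!}{m_1!\cdots m_\ell!}\int_{\mathbb R^\ell}\prod_{i=1}^{\ell}f(x_i)^{m_i}K(x_i,x_{i+1})\,dx_1\cdots dx_\ell\qquad(x_{\ell+1}=x_1).$$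 Two families of kernels $(K^N)_{N>0}$, $(L^N)_{N>0}$ are asymptotically equivalent, $K^N\cong L^N$, if for all continuous compactly supported $f:\mathbb R\to\mathbb R$ and all $n\ge1$ their cumulants have the same asymptotics, $\lim_{N\to\infty}\big(C^n_{K^N}[\Xi f]-C^n_{L^N}[\Xi f]\big)=0$ (so if either cumulant has a finite or infinite limit, the other one has the same limit). **Proposition.** Let $\Psi\in\mathfrak F'$, $\tau>0$ and $1/3<\alpha<1$. Then for every $N>0$ the series defining $K^N_{\Psi,\alpha}$ converges absolutely at all $x,y\in\mathbb R$ and the integrals in the cumulants of the two kernels below converge absolutely, and as $N\to\infty$ $$N^{-\alpha}K^N_{\Psi,\alpha}(xN^{-\alpha},yN^{-\alpha})\;\cong\;L^N_{\Psi,\eta}(x,y).$$ -/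

import Mathlib

open Filter Topology MeasureTheory

noncomputable section

/-- `g` is Riemann integrable on every bounded interval `[a, b]` (Mathlib's Riemann box integral in
dimension one, with respect to Lebesgue measure). -/
def IsLocallyRiemannIntegrable (g : ℝ → ℝ) : Prop :=
  ∀ (a b : ℝ) (hab : a < b),
    BoxIntegral.Integrable
      (⟨fun _ => a, fun _ => b, fun _ => hab⟩ : BoxIntegral.Box (Fin 1))
      BoxIntegral.IntegrationParams.Riemann
      (fun x : Fin 1 → ℝ => g (x 0))
      (volume : Measure (Fin 1 → ℝ)).toBoxAdditive.toSMul

/-- The class `𝔉` of shapes: differentiable non-increasing functions `Ψ : ℝ → [0,1]` with Riemann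
integrable derivative such that `Ψ ∈ L¹(0,∞)` and `1 - Ψ ∈ L¹(-∞,0)`. (Since `Ψ` is bounded and
monotone, the improper Riemann integral of `Ψ'` over `ℝ` then converges automatically.) -/
structure IsShape (Ψ : ℝ → ℝ) : Prop where
  mem_Icc : ∀ x, Ψ x ∈ Set.Icc (0 : ℝ) 1
  differentiable : Differentiable ℝ Ψ
  deriv_nonpos : ∀ x, deriv Ψ x ≤ 0
  riemann : IsLocallyRiemannIntegrable (deriv Ψ)
  integrableOn_right : IntegrableOn Ψ (Set.Ioi 0)
  integrableOn_left : IntegrableOn (fun x => 1 - Ψ x) (Set.Iio 0)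

/-- The density `Φ = -Ψ'` of a shape. -/
def shapeDensity (Ψ : ℝ → ℝ) (x : ℝ) : ℝ := -deriv Ψ x

/-- The subclass `𝔉'`: shapes with `Φ(x) ≤ exp(-c|x|)` for some `c > 0` and all `x`. -/
structure IsExpShape (Ψ : ℝ → ℝ) : Prop extends IsShape Ψ where
  density_le : ∃ c : ℝ, 0 < c ∧ ∀ x, shapeDensity Ψ x ≤ Real.exp (-c * |x|)

/-- The Hermite functions
`h_n(x) = exp(x²/2) (-1)ⁿ / √(n! 2ⁿ √π) · dⁿ/dxⁿ exp(-x²)`. -/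
def hermiteFun (n : ℕ) (x : ℝ) : ℝ :=
  Real.exp (x ^ 2 / 2) * ((-1) ^ n / √((n.factorial : ℝ) * 2 ^ n * √Real.pi)) *
    iteratedDeriv n (fun t : ℝ => Real.exp (-t ^ 2)) x

/-- The rescaled Hermite functions `φ_k(x) = √(π√N/√2) h_k(x π√N/√2)`. -/
def rescaledHermite (N : ℝ) (k : ℕ) (x : ℝ) : ℝ :=
  √(Real.pi * √N / √2) * hermiteFun k (x * (Real.pi * √N / √2))

/-- The general term `Ψ((k-N)/(τ N^α)) φ_k(x) φ_k(y)` of the series for the modified GUE kernel. -/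
def modifiedGUETerm (Ψ : ℝ → ℝ) (τ α N x y : ℝ) (k : ℕ) : ℝ :=
  Ψ (((k : ℝ) - N) / (τ * N ^ α)) * rescaledHermite N k x * rescaledHermite N k y

/-- The correlation kernel of the modified GUE with shape `Ψ`, temperature `τ`, modification
scale `α` and density `N`. -/
def modifiedGUEKernel (Ψ : ℝ → ℝ) (τ α N x y : ℝ) : ℝ :=
  ∑' k : ℕ, modifiedGUETerm Ψ τ α N x y k

/-- The sine kernel `sin(2πη u)/(πu)`, continuously extended by `2η` at `u = 0`. -/
def sineFun (η u : ℝ) : ℝ :=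
  if u = 0 then 2 * η else Real.sin (2 * Real.pi * η * u) / (Real.pi * u)

/-- `ξ` is a point of `(0,1)` given by the mean value theorem for `Ψ` on
`[k/(τ N^α), (k+1)/(τ N^α)]`. -/
def IsMeanValuePoint (Ψ : ℝ → ℝ) (τ α N : ℝ) (k : ℤ) (ξ : ℝ) : Prop :=
  ξ ∈ Set.Ioo (0 : ℝ) 1 ∧
    1 / (τ * N ^ α) * shapeDensity Ψ (((k : ℝ) + ξ) / (τ * N ^ α)) =
      Ψ ((k : ℝ) / (τ * N ^ α)) - Ψ (((k : ℝ) + 1) / (τ * N ^ α))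

/-- Mean value points exist for every differentiable function. -/
theorem exists_isMeanValuePoint {Ψ : ℝ → ℝ} (hΨ : Differentiable ℝ Ψ) {τ N : ℝ} (hτ : 0 < τ)
    (hN : 0 < N) (α : ℝ) (k : ℤ) : ∃ ξ, IsMeanValuePoint Ψ τ α N k ξ := by
  have hs : 0 < τ * N ^ α := mul_pos hτ (Real.rpow_pos_of_pos hN α)
  set s := τ * N ^ α with hs_def
  have hlt : (k : ℝ) / s < ((k : ℝ) + 1) / s := by gcongr; linarith
  obtain ⟨c, ⟨hc1, hc2⟩, hc⟩ :=
    exists_deriv_eq_slope Ψ hlt hΨ.continuous.continuousOn hΨ.differentiableOn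
  refine ⟨c * s - k, ⟨?_, ?_⟩, ?_⟩
  · rw [div_lt_iff₀ hs] at hc1; linarith
  · rw [lt_div_iff₀ hs] at hc2; linarith
  · have h1 : ((k : ℝ) + (c * s - k)) / s = c := by field_simp; ring
    have h2 : ((k : ℝ) + 1) / s - (k : ℝ) / s = 1 / s := by ring
    rw [← hs_def, h1, shapeDensity, hc, h2]
    field_simp
    ring

/-- The mixture of sine kernels
`L(x,y) = 1/(τN^α) ∑_{|k| ≤ Γ N^α} Φ((k+ξ_k)/(τN^α)) sin(2πη(k)(x-y)) / (π(x-y))`. -/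
def sineMixtureKernel (Ψ : ℝ → ℝ) (τ α Γ : ℝ) (η : ℤ → ℝ) (ξ : ℤ → ℝ) (N x y : ℝ) : ℝ :=
  1 / (τ * N ^ α) * ∑ k ∈ Finset.Icc (-⌊Γ * N ^ α⌋) ⌊Γ * N ^ α⌋,
    shapeDensity Ψ (((k : ℝ) + ξ k) / (τ * N ^ α)) * sineFun (η k) (x - y)

/-- The integrand `∏ᵢ f(xᵢ)^{mᵢ} K(xᵢ, xᵢ₊₁)`, with cyclic indices, of the trace
`Tr[f^{m₁} K ⋯ f^{m_ℓ} K]` attached to a composition `m` of `n` of length `ℓ`. -/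
def traceIntegrand (K : ℝ → ℝ → ℝ) (f : ℝ → ℝ) {n : ℕ} (m : Composition n)
    (x : Fin m.length → ℝ) : ℝ :=
  ∏ i, f (x i) ^ m.blocksFun i * K (x i) (x (finRotate m.length i))

/-- The `n`-th cumulant of the linear statistic of `f` with respect to the kernel `K`:
`∑_m (-1)^{ℓ+1}/ℓ · n!/(m₁!⋯m_ℓ!) · Tr[f^{m₁} K ⋯ f^{m_ℓ} K]`,
summed over the compositions `m` of `n`. -/
def kernelCumulant (K : ℝ → ℝ → ℝ) (f : ℝ → ℝ) (n : ℕ) : ℝ :=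
  ∑ m : Composition n,
    (-1) ^ (m.length + 1) / (m.length : ℝ) *
      ((n.factorial : ℝ) / ∏ i, ((m.blocksFun i).factorial : ℝ)) *
      ∫ x : Fin m.length → ℝ, traceIntegrand K f m x

/-- All the traces that occur in the cumulants of `K`, for continuous compactly supported test
functions, are absolutely convergent integrals. -/
def HasCumulants (K : ℝ → ℝ → ℝ) : Prop :=
  ∀ f : ℝ → ℝ, Continuous f → HasCompactSupport f → ∀ n : ℕ, 1 ≤ n → ∀ m : Composition n,
    Integrable (traceIntegrand K f m)

/-- Asymptotic equivalence of two families of kernels on `ℝ`: for every continuous compactly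
supported `f` and every `n ≥ 1`, the cumulants `C^n_{K^N}[Ξf]` and `C^n_{L^N}[Ξf]` have the same
asymptotics as `N → ∞`. As these cumulants may diverge (for instance the mean, `n = 1`), this is
expressed by their difference tending to `0`; in particular, if one of them has a limit, finite or
infinite, then the other one has the same limit. -/
def AsymptoticallyEquivalent (K L : ℝ → ℝ → ℝ → ℝ) : Prop :=
  ∀ f : ℝ → ℝ, Continuous f → HasCompactSupport f → ∀ n : ℕ, 1 ≤ n →
    Tendsto (fun N : ℝ => kernelCumulant (K N) f n - kernelCumulant (L N) f n) atTop (𝓝 0)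

/-- The modified GUE kernel at its own scale: `N^{-α} K^N(x N^{-α}, y N^{-α})`. -/
def criticalModifiedGUEKernel (Ψ : ℝ → ℝ) (τ α N x y : ℝ) : ℝ :=
  N ^ (-α) * modifiedGUEKernel Ψ τ α N (x * N ^ (-α)) (y * N ^ (-α))

/-- The mixture of sine kernels with `Γ = (log N)²` and `η(k) = N^{1-α} √(1 + k/N) / 2`. -/
def criticalSineMixtureKernel (Ψ : ℝ → ℝ) (τ α : ℝ) (ξ : ℝ → ℤ → ℝ) (N x y : ℝ) : ℝ :=
  sineMixtureKernel Ψ τ α (Real.log N ^ 2)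
    (fun k => N ^ (1 - α) * √(1 + (k : ℝ) / N) / 2) (ξ N) N x y

end

/-! Summation by parts turns the modified kernel into a mixture of Christoffel–Darboux kernels: with
n₀ = ⌊N⌋ the order n₀+1+k carries the weight Ψ(k/(τN^α)) - Ψ((k+1)/(τN^α)), which by the choice of
ξ_k is exactly the weight of the k-th sine kernel in the mixture. The weights are non-negative with
sum at most 1, so it suffices to compare each Christoffel–Darboux kernel with a sine kernel,
uniformly on compact sets (`abs_tsum_profile_sub_mixture_le`, `critical_kernels_sub_le`). The
exponential tails of Ψ make the cut-off |k| ≤ (log N)² N^α cost less than any power of N.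

No Plancherel–Rotach asymptotics are used. The pair (h_{n+1}, h_n) solves a first order linear
system, and the diagonal kernel is a quadratic form in it that changes slowly with the point;
Wallis' product gives its value at 0. Off the diagonal, the Christoffel–Darboux numerator nearly
solves Z'' + ω²Z = 0 with ω² ≈ 2n, and variation of constants compares it with a sine
(`hermiteKernel_sub_sinc_le`), with error O((1 + X²)/ω) on [-X, X]. At scale N^{-α} one has X ~
N^{1/2-α}, so the rescaled kernels differ by O(N^{1-3α} + N^{-α}), up to the negligible tail; this
is where α > 1/3 enters.

The kernels themselves may be unbounded as N grows, so uniform closeness must still be carried over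
to the traces. Interpolation between |sin| ≤ 1 and |sinc| ≤ 1 bounds both by (2N)^κ |x-y|^{κ-1} + 1,
whose row integrals over the support are O(N^κ) for any small κ > 0. Changing one kernel at a time
in a trace of length ℓ costs the uniform error times ℓ - 1 row integrals, and κ can be chosen so
that the product tends to 0 (`enorm_trace_sub_le`, `tendsto_trace_sub`). -/

/-! ### Recurrences and ladder relations for the Hermite functions. -/

theorem hasDerivAt_iteratedDeriv_gaussian (n : ℕ) (x : ℝ) :
    HasDerivAt (iteratedDeriv n (fun t : ℝ => Real.exp (-t ^ 2)))
      (iteratedDeriv (n + 1) (fun t : ℝ => Real.exp (-t ^ 2)) x) x := by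
  rw [iteratedDeriv_succ]
  have h : ContDiff ℝ (n + 1 : ℕ) (fun t : ℝ => Real.exp (-t ^ 2)) := by fun_prop
  exact ((h.differentiable_iteratedDeriv n (by exact_mod_cast Nat.lt_succ_self n)) x).hasDerivAt

theorem iteratedDeriv_gaussian_one (x : ℝ) :
    iteratedDeriv 1 (fun t : ℝ => Real.exp (-t ^ 2)) x = -2 * x * Real.exp (-x ^ 2) := by
  rw [iteratedDeriv_one]
  have h : HasDerivAt (fun t : ℝ => Real.exp (-t ^ 2)) (Real.exp (-x ^ 2) * (-(2 * x))) x := by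
    have := ((hasDerivAt_pow 2 x).neg).exp
    simpa using this
  rw [h.deriv]; ring

/-- Repeated differentiation of g' = -2xg, each step by uniqueness of the derivative. -/
theorem iteratedDeriv_gaussian_add_two (n : ℕ) (x : ℝ) :
    iteratedDeriv (n + 2) (fun t : ℝ => Real.exp (-t ^ 2)) x =
      -2 * x * iteratedDeriv (n + 1) (fun t : ℝ => Real.exp (-t ^ 2)) x -
        2 * (n + 1) * iteratedDeriv n (fun t : ℝ => Real.exp (-t ^ 2)) x := by
  induction n generalizing x with
  | zero =>
    have h1 : iteratedDeriv 1 (fun t : ℝ => Real.exp (-t ^ 2)) =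
        fun x => -2 * x * iteratedDeriv 0 (fun t : ℝ => Real.exp (-t ^ 2)) x := by
      ext y; rw [iteratedDeriv_gaussian_one, iteratedDeriv_zero]
    have h2 := hasDerivAt_iteratedDeriv_gaussian 1 x
    have h3 := ((hasDerivAt_id x).const_mul (-2)).mul (hasDerivAt_iteratedDeriv_gaussian 0 x)
    rw [h1] at h2
    have := h2.unique h3
    simp only [id_eq] at this
    norm_num at this ⊢
    rw [this]; ring
  | succ n ih =>
    have h2 := hasDerivAt_iteratedDeriv_gaussian (n + 2) x
    have h3 := (((hasDerivAt_id x).const_mul (-2)).mul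
      (hasDerivAt_iteratedDeriv_gaussian (n + 1) x)).sub
        ((hasDerivAt_iteratedDeriv_gaussian n x).const_mul (2 * ((n : ℝ) + 1)))
    rw [show iteratedDeriv (n + 2) (fun t : ℝ => Real.exp (-t ^ 2)) = _ from funext ih] at h2
    have := h2.unique h3
    simp only [id_eq] at this
    rw [show n + 1 + 2 = n + 2 + 1 from rfl, this]
    push_cast
    ring

/-- The normalising factors of consecutive Hermite functions. -/
theorem hermite_normalization_succ (n : ℕ) :
    √(((n + 1).factorial : ℝ) * 2 ^ (n + 1) * √Real.pi) =
      √(2 * ((n : ℝ) + 1)) * √((n.factorial : ℝ) * 2 ^ n * √Real.pi) := by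
  rw [← Real.sqrt_mul (by positivity)]
  congr 1
  rw [Nat.factorial_succ]; push_cast; ring

theorem hasDerivAt_hermiteFun (n : ℕ) (x : ℝ) :
    HasDerivAt (hermiteFun n)
      (x * hermiteFun n x - √(2 * ((n : ℝ) + 1)) * hermiteFun (n + 1) x) x := by
  have h1 : HasDerivAt (fun x : ℝ => Real.exp (x ^ 2 / 2)) (Real.exp (x ^ 2 / 2) * x) x := by
    have := ((hasDerivAt_pow 2 x).div_const 2).exp
    simpa using this
  have h2 := (h1.mul_const ((-1) ^ n / √((n.factorial : ℝ) * 2 ^ n * √Real.pi))).mul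
    (hasDerivAt_iteratedDeriv_gaussian n x)
  have hpos : 0 < √((n.factorial : ℝ) * 2 ^ n * √Real.pi) := by positivity
  have hpos' : 0 < √(2 * ((n : ℝ) + 1)) := by positivity
  have h3 : HasDerivAt (hermiteFun n) _ x := h2
  refine h3.congr_deriv ?_
  simp only [hermiteFun, hermite_normalization_succ]
  field_simp
  ring

theorem hermiteFun_add_two (n : ℕ) (x : ℝ) :
    √(2 * ((n : ℝ) + 2)) * hermiteFun (n + 2) x =
      2 * x * hermiteFun (n + 1) x - √(2 * ((n : ℝ) + 1)) * hermiteFun n x := by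
  have hpos : 0 < √((n.factorial : ℝ) * 2 ^ n * √Real.pi) := by positivity
  have hpos' : 0 < √(2 * ((n : ℝ) + 1)) := by positivity
  have hpos'' : 0 < √(2 * ((n : ℝ) + 2)) := by positivity
  have hsq : √(2 * ((n : ℝ) + 1)) ^ 2 = 2 * ((n : ℝ) + 1) := Real.sq_sqrt (by positivity)
  have e : √(2 * (((n + 1 : ℕ) : ℝ) + 1)) = √(2 * ((n : ℝ) + 2)) := by
    congr 1; push_cast; ring
  simp only [hermiteFun, hermite_normalization_succ, iteratedDeriv_gaussian_add_two, e]
  field_simp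
  rw [hsq]
  ring

theorem hermiteFun_one (x : ℝ) : √2 * hermiteFun 1 x = 2 * x * hermiteFun 0 x := by
  have hpos : 0 < √√Real.pi := by positivity
  have e := hermite_normalization_succ 0
  simp only [Nat.cast_zero, zero_add, mul_one, Nat.factorial_zero, pow_zero, Nat.cast_one,
    one_mul] at e
  simp only [hermiteFun, e, iteratedDeriv_gaussian_one, iteratedDeriv_zero]
  simp
  field_simp

/-- Together with `hasDerivAt_hermiteFun` this closes the system for p = h_{n+1}, q = h_n: p' = bq -
tp and q' = tq - bp, with b = √(2(n+1)). -/
theorem hasDerivAt_hermiteFun_succ (n : ℕ) (x : ℝ) :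
    HasDerivAt (hermiteFun (n + 1))
      (√(2 * ((n : ℝ) + 1)) * hermiteFun n x - x * hermiteFun (n + 1) x) x := by
  have h := hasDerivAt_hermiteFun (n + 1) x
  have e : √(2 * (((n + 1 : ℕ) : ℝ) + 1)) = √(2 * ((n : ℝ) + 2)) := by
    congr 1; push_cast; ring
  rw [e, hermiteFun_add_two] at h
  convert h using 1; ring

/-! ### The Christoffel–Darboux formula, off and on the diagonal. -/

/-- The Christoffel–Darboux kernel `∑_{j<M} h_j(u) h_j(v)` of the Hermite functions. -/
noncomputable def hermiteKernel (M : ℕ) (u v : ℝ) : ℝ :=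
  ∑ j ∈ Finset.range M, hermiteFun j u * hermiteFun j v

theorem sub_mul_hermiteKernel (n : ℕ) (u v : ℝ) :
    (u - v) * hermiteKernel (n + 1) u v = √(2 * ((n : ℝ) + 1)) / 2 *
      (hermiteFun (n + 1) u * hermiteFun n v - hermiteFun n u * hermiteFun (n + 1) v) := by
  induction n with
  | zero =>
    have h1 := hermiteFun_one u
    have h2 := hermiteFun_one v
    simp [hermiteKernel]
    linear_combination hermiteFun 0 u * h2 / 2 - hermiteFun 0 v * h1 / 2
  | succ n ih =>
    have h1 := hermiteFun_add_two n u
    have h2 := hermiteFun_add_two n v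
    have e : √(2 * (((n + 1 : ℕ) : ℝ) + 1)) = √(2 * ((n : ℝ) + 2)) := by
      congr 1; push_cast; ring
    rw [hermiteKernel, Finset.sum_range_succ, mul_add, ← hermiteKernel, ih, e]
    linear_combination hermiteFun (n + 1) u * h2 / 2 - hermiteFun (n + 1) v * h1 / 2

/-- The confluent form of the Christoffel–Darboux formula, by induction rather than as a limit. It
makes the diagonal a quadratic form in (h_{n+1}, h_n), positive definite for |v| < b with b =
√(2(n+1)). -/
theorem hermiteKernel_self (n : ℕ) (v : ℝ) :
    hermiteKernel (n + 1) v v = √(2 * ((n : ℝ) + 1)) ^ 2 / 2 *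
      (hermiteFun (n + 1) v ^ 2 + hermiteFun n v ^ 2) -
        √(2 * ((n : ℝ) + 1)) * v * hermiteFun (n + 1) v * hermiteFun n v := by
  induction n with
  | zero =>
    have h1 := hermiteFun_one v
    have hsq : √2 ^ 2 = (2 : ℝ) := Real.sq_sqrt (by positivity)
    simp [hermiteKernel]
    linear_combination (-√2 * hermiteFun 1 v / 2) * h1 + hermiteFun 1 v ^ 2 * hsq / 2
  | succ n ih =>
    have h1 := hermiteFun_add_two n v
    have e : √(2 * (((n + 1 : ℕ) : ℝ) + 1)) = √(2 * ((n : ℝ) + 2)) := by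
      congr 1; push_cast; ring
    have s1 : √(2 * ((n : ℝ) + 1)) ^ 2 = 2 * ((n : ℝ) + 1) := Real.sq_sqrt (by positivity)
    have s2 : √(2 * ((n : ℝ) + 2)) ^ 2 = 2 * ((n : ℝ) + 2) := Real.sq_sqrt (by positivity)
    rw [hermiteKernel, Finset.sum_range_succ, ← hermiteKernel, ih, e]
    generalize √(2 * ((n : ℝ) + 1)) = b at *
    generalize √(2 * ((n : ℝ) + 2)) = c at *
    generalize hermiteFun (n + 2) v = r at *
    generalize hermiteFun (n + 1) v = p at *
    generalize hermiteFun n v = q at *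
    linear_combination (-(c * r + (2 * v * p - b * q)) / 2 + v * p) * h1 + p ^ 2 / 2 * (s1 - s2)

/-! ### The diagonal at the origin, by Wallis' product. -/

theorem hermiteFun_add_two_zero (n : ℕ) :
    hermiteFun (n + 2) 0 ^ 2 = ((n : ℝ) + 1) / (n + 2) * hermiteFun n 0 ^ 2 := by
  have h := hermiteFun_add_two n 0
  have s1 : √(2 * ((n : ℝ) + 1)) ^ 2 = 2 * ((n : ℝ) + 1) := Real.sq_sqrt (by positivity)
  have s2 : √(2 * ((n : ℝ) + 2)) ^ 2 = 2 * ((n : ℝ) + 2) := Real.sq_sqrt (by positivity)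
  have h' : √(2 * ((n : ℝ) + 2)) ^ 2 * hermiteFun (n + 2) 0 ^ 2 =
      √(2 * ((n : ℝ) + 1)) ^ 2 * hermiteFun n 0 ^ 2 := by
    rw [← mul_pow, h]; ring
  rw [s1, s2] at h'
  field_simp
  linarith

theorem hermiteFun_zero_zero : hermiteFun 0 0 ^ 2 = 1 / √Real.pi := by
  simp [hermiteFun, Real.sq_sqrt]

theorem hermiteFun_odd_zero (j : ℕ) : hermiteFun (2 * j + 1) 0 = 0 := by
  induction j with
  | zero =>
    have h := hermiteFun_one 0
    simpa using h
  | succ j ih =>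
    have h := hermiteFun_add_two_zero (2 * j + 1)
    rw [ih] at h
    simpa [show 2 * (j + 1) + 1 = 2 * j + 1 + 2 by ring] using h

/-- From j to j+1 the fourth power gains ((2j+1)/(2j+2))², while (2j+1)W_j gains the inverse factor.
-/
theorem hermiteFun_even_zero (j : ℕ) :
    hermiteFun (2 * j) 0 ^ 4 * ((2 * (j : ℝ) + 1) * Real.Wallis.W j) = 1 / Real.pi := by
  induction j with
  | zero =>
    have h := hermiteFun_zero_zero
    have : hermiteFun (2 * 0) 0 ^ 4 = (hermiteFun 0 0 ^ 2) ^ 2 := by ring_nf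
    rw [this, h, div_pow, Real.sq_sqrt Real.pi_pos.le]
    simp [Real.Wallis.W]
  | succ j ih =>
    have h := hermiteFun_add_two_zero (2 * j)
    rw [← ih, Real.Wallis.W_succ, show 2 * (j + 1) = 2 * j + 2 by ring,
      show hermiteFun (2 * j + 2) 0 ^ 4 = (hermiteFun (2 * j + 2) 0 ^ 2) ^ 2 by ring, h]
    push_cast
    field_simp
    ring

/-- Wallis' product, as an estimate for the density of the Hermite kernel at the origin. -/
theorem abs_hermiteKernel_zero_sq_sub_le (n : ℕ) :
    |hermiteKernel (n + 1) 0 0 ^ 2 - 2 * ((n : ℝ) + 1) / Real.pi ^ 2| ≤ 2 / Real.pi ^ 2 := by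
  have s1 : √(2 * ((n : ℝ) + 1)) ^ 2 = 2 * ((n : ℝ) + 1) := Real.sq_sqrt (by positivity)
  have hpi := Real.pi_pos
  have hE := hermiteKernel_self n 0
  rw [s1] at hE
  -- At 0 only the even one of h_n, h_{n+1} survives, so the squared kernel is (n+1)² times a fourth
  -- power, which the two-sided Wallis bounds control.
  have key : |hermiteKernel (n + 1) 0 0 ^ 2 * Real.pi ^ 2 / 2 - ((n : ℝ) + 1)| ≤ 1 := by
    rcases Nat.even_or_odd' n with ⟨j, rfl | rfl⟩
    · have h0 := hermiteFun_odd_zero j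
      have h1 := hermiteFun_even_zero j
      have hW1 := Real.Wallis.W_le j
      have hW2 := Real.Wallis.le_W j
      have hW := Real.Wallis.W_pos j
      rw [h0] at hE
      have e : hermiteKernel (2 * j + 1) 0 0 ^ 2 * Real.pi ^ 2 / 2 =
          (2 * (j : ℝ) + 1) * ((Real.pi / 2) / Real.Wallis.W j) := by
        rw [hE]
        push_cast
        have : hermiteFun (2 * j) 0 ^ 4 =
            1 / Real.pi / ((2 * (j : ℝ) + 1) * Real.Wallis.W j) := by
          rw [eq_div_iff (by positivity), h1]
        rw [show ∀ a b : ℝ, (2 * (a + 1) / 2 * (0 ^ 2 + b ^ 2) - √(2 * (a + 1)) * 0 * 0 * b) ^ 2 =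
          (a + 1) ^ 2 * b ^ 4 by intros; ring, this]
        field_simp
      rw [e]
      push_cast
      have l1 : 1 ≤ (Real.pi / 2) / Real.Wallis.W j := by rw [le_div_iff₀ hW]; linarith
      have l2 : (Real.pi / 2) / Real.Wallis.W j ≤ (2 * j + 2) / (2 * j + 1) := by
        rw [div_le_div_iff₀ hW (by positivity)]
        rw [div_mul_eq_mul_div, div_le_iff₀ (by positivity)] at hW2
        linarith
      rw [le_div_iff₀ (by positivity)] at l2
      rw [abs_le]
      constructor <;> nlinarith
    · have h0 := hermiteFun_odd_zero j
      have h1 := hermiteFun_even_zero (j + 1)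
      have hW1 := Real.Wallis.W_le (j + 1)
      have hW2 := Real.Wallis.le_W (j + 1)
      have hW := Real.Wallis.W_pos (j + 1)
      rw [h0] at hE
      push_cast at h1 hW2
      have e : hermiteKernel (2 * j + 1 + 1) 0 0 ^ 2 * Real.pi ^ 2 / 2 =
          (2 * (j : ℝ) + 2) ^ 2 / (2 * j + 3) * ((Real.pi / 2) / Real.Wallis.W (j + 1)) := by
        rw [hE]
        push_cast
        have : hermiteFun (2 * j + 1 + 1) 0 ^ 4 =
            1 / Real.pi / ((2 * ((j : ℝ) + 1) + 1) * Real.Wallis.W (j + 1)) := by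
          rw [eq_div_iff (by positivity), ← h1]; ring_nf
        rw [show ∀ a b : ℝ, (2 * (a + 1) / 2 * (b ^ 2 + 0 ^ 2) - √(2 * (a + 1)) * 0 * b * 0) ^ 2 =
          (a + 1) ^ 2 * b ^ 4 by intros; ring, this]
        field_simp
        ring
      rw [e]
      push_cast
      have l1 : 1 ≤ (Real.pi / 2) / Real.Wallis.W (j + 1) := by rw [le_div_iff₀ hW]; linarith
      have l2 : (Real.pi / 2) / Real.Wallis.W (j + 1) ≤ (2 * j + 4) / (2 * j + 3) := by
        rw [div_le_div_iff₀ hW (by positivity)]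
        rw [div_mul_eq_mul_div, div_le_iff₀ (by positivity)] at hW2
        linarith
      have l3 : 2 * (j : ℝ) + 1 ≤ (2 * (j : ℝ) + 2) ^ 2 / (2 * j + 3) := by
        rw [le_div_iff₀ (by positivity)]; nlinarith
      have l4 : (2 * (j : ℝ) + 2) ^ 2 / (2 * j + 3) * ((2 * j + 4) / (2 * j + 3)) ≤ 2 * j + 2 := by
        rw [div_mul_div_comm, div_le_iff₀ (by positivity)]
        have : (0 : ℝ) ≤ j := Nat.cast_nonneg j
        nlinarith
      have l5 : (0 : ℝ) ≤ (2 * (j : ℝ) + 2) ^ 2 / (2 * j + 3) := by positivity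
      rw [abs_le]
      constructor
      · nlinarith [mul_le_mul_of_nonneg_left l1 l5]
      · nlinarith [mul_le_mul_of_nonneg_left l2 l5]
  have e2 : hermiteKernel (n + 1) 0 0 ^ 2 - 2 * ((n : ℝ) + 1) / Real.pi ^ 2 =
      (hermiteKernel (n + 1) 0 0 ^ 2 * Real.pi ^ 2 / 2 - ((n : ℝ) + 1)) * (2 / Real.pi ^ 2) := by
    field_simp
  rw [e2, abs_mul, abs_of_pos (show 0 < 2 / Real.pi ^ 2 by positivity)]
  exact mul_le_of_le_one_left (by positivity) key

theorem hermiteKernel_self_nonneg (M : ℕ) (v : ℝ) : 0 ≤ hermiteKernel M v v :=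
  Finset.sum_nonneg fun _ _ => mul_self_nonneg _

theorem hermiteKernel_zero_le (n : ℕ) :
    hermiteKernel (n + 1) 0 0 ≤ √(2 * ((n : ℝ) + 1)) / 2 := by
  have h := (abs_le.1 (abs_hermiteKernel_zero_sq_sub_le n)).2
  have hpi := Real.pi_gt_three
  have hn : (0 : ℝ) ≤ n := Nat.cast_nonneg n
  refine abs_le_of_sq_le_sq' ?_ (by positivity) |>.2
  rw [div_pow, Real.sq_sqrt (by positivity)]
  have h1 : 2 / Real.pi ^ 2 ≤ 2 / 8 := by
    apply div_le_div_of_nonneg_left <;> nlinarith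
  have h2 : 2 * ((n : ℝ) + 1) / Real.pi ^ 2 = 2 / Real.pi ^ 2 * (n + 1) := by ring
  rw [h2] at h
  nlinarith

/-! ### Bounds on the diagonal and on single Hermite functions. -/

/-- The diagonal of the Hermite kernel is a quadratic form in `(h_{n+1}, h_n)` whose variation is
controlled by `∫ t h_{n+1}(t)² dt`. -/
theorem hasDerivAt_hermiteKernel_self (n : ℕ) (v : ℝ) :
    HasDerivAt (fun v => hermiteKernel (n + 1) v v + hermiteFun (n + 1) v ^ 2 / 2)
      (-v * hermiteFun (n + 1) v ^ 2) v := by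
  have hp := hasDerivAt_hermiteFun_succ n v
  have hq := hasDerivAt_hermiteFun n v
  simp only [hermiteKernel_self]
  set b := √(2 * ((n : ℝ) + 1))
  have h := ((((hp.pow 2).add (hq.pow 2)).const_mul (b ^ 2 / 2)).sub
    ((((hasDerivAt_id v).const_mul b).mul hp).mul hq)).add ((hp.pow 2).div_const 2)
  refine h.congr_deriv ?_
  simp
  ring

/-- The derivative -v h_{n+1}(v)² has the sign of -v, so the maximum is at 0. The bound is valid on
the whole line, including the edge of the spectrum. -/
theorem hermiteKernel_self_add_le (n : ℕ) (v : ℝ) :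
    hermiteKernel (n + 1) v v + hermiteFun (n + 1) v ^ 2 / 2 ≤
      hermiteKernel (n + 1) 0 0 + hermiteFun (n + 1) 0 ^ 2 / 2 := by
  set F := fun v => hermiteKernel (n + 1) v v + hermiteFun (n + 1) v ^ 2 / 2 with hF
  have hd := hasDerivAt_hermiteKernel_self n
  have hdiff : Differentiable ℝ F := fun v => (hd v).differentiableAt
  rcases le_total 0 v with hv | hv
  · have : AntitoneOn F (Set.Ici 0) := by
      apply antitoneOn_of_deriv_nonpos (convex_Ici 0) hdiff.continuous.continuousOn
        hdiff.differentiableOn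
      intro x hx
      rw [interior_Ici] at hx
      rw [(hd x).deriv]
      nlinarith [sq_nonneg (hermiteFun (n + 1) x), Set.mem_Ioi.1 hx]
    exact this (Set.mem_Ici.2 le_rfl) hv hv
  · have : MonotoneOn F (Set.Iic 0) := by
      apply monotoneOn_of_deriv_nonneg (convex_Iic 0) hdiff.continuous.continuousOn
        hdiff.differentiableOn
      intro x hx
      rw [interior_Iic] at hx
      rw [(hd x).deriv]
      nlinarith [sq_nonneg (hermiteFun (n + 1) x), Set.mem_Iio.1 hx]
    exact this hv (Set.mem_Iic.2 le_rfl) hv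

theorem hermiteKernel_self_le (n : ℕ) (v : ℝ) :
    hermiteKernel (n + 1) v v ≤ √(2 * ((n : ℝ) + 1)) := by
  have h1 := hermiteKernel_self_add_le n v
  have h2 := hermiteKernel_zero_le n
  have h3 := hermiteKernel_self n 0
  have s1 : √(2 * ((n : ℝ) + 1)) ^ 2 = 2 * ((n : ℝ) + 1) := Real.sq_sqrt (by positivity)
  rw [s1] at h3
  have hn : (0 : ℝ) ≤ n := Nat.cast_nonneg n
  have : hermiteFun (n + 1) 0 ^ 2 ≤ hermiteKernel (n + 1) 0 0 := by
    rw [h3]; nlinarith [sq_nonneg (hermiteFun (n + 1) 0), sq_nonneg (hermiteFun n 0)]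
  have h4 : 0 ≤ √(2 * ((n : ℝ) + 1)) := Real.sqrt_nonneg _
  nlinarith [sq_nonneg (hermiteFun (n + 1) v)]

/-- A single term of the diagonal sum. Crude, but uniform in v; it serves wherever the profile
decays exponentially. -/
theorem hermiteFun_sq_le (n : ℕ) (v : ℝ) : hermiteFun n v ^ 2 ≤ √(2 * ((n : ℝ) + 1)) := by
  refine le_trans ?_ (hermiteKernel_self_le n v)
  rw [hermiteKernel, Finset.sum_range_succ, ← sq]
  exact le_add_of_nonneg_left (hermiteKernel_self_nonneg n v)

theorem abs_hermiteFun_mul_le (n : ℕ) (u v : ℝ) :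
    |hermiteFun n u * hermiteFun n v| ≤ √(2 * ((n : ℝ) + 1)) := by
  have h1 := hermiteFun_sq_le n u
  have h2 := hermiteFun_sq_le n v
  rw [abs_le]
  constructor <;> nlinarith [sq_nonneg (hermiteFun n u + hermiteFun n v),
    sq_nonneg (hermiteFun n u - hermiteFun n v)]

/-- For |v| ≤ b/2, where b = √(2(n+1)), the quadratic form of `hermiteKernel_self` dominates
(b²/4)(h_{n+1}² + h_n²), and the form is at most b. -/
theorem hermiteFun_sq_add_sq_le (n : ℕ) {v : ℝ} (hv : |v| ≤ √(2 * ((n : ℝ) + 1)) / 2) :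
    hermiteFun (n + 1) v ^ 2 + hermiteFun n v ^ 2 ≤ 4 / √(2 * ((n : ℝ) + 1)) := by
  have h1 := hermiteKernel_self_le n v
  have hb : 0 < √(2 * ((n : ℝ) + 1)) := by positivity
  rw [hermiteKernel_self] at h1
  set b := √(2 * ((n : ℝ) + 1))
  set p := hermiteFun (n + 1) v
  set q := hermiteFun n v
  rw [le_div_iff₀ hb]
  have h2 : v * p * q ≤ b / 4 * (p ^ 2 + q ^ 2) := by
    have : |p * q| ≤ (p ^ 2 + q ^ 2) / 2 := by
      rw [abs_le]; constructor <;> nlinarith [sq_nonneg (p + q), sq_nonneg (p - q)]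
    calc v * p * q ≤ |v * p * q| := le_abs_self _
      _ = |v| * |p * q| := by rw [mul_assoc, abs_mul]
      _ ≤ b / 2 * ((p ^ 2 + q ^ 2) / 2) := by gcongr
      _ = _ := by ring
  have h3 : b * (b * (p ^ 2 + q ^ 2)) ≤ b * 4 := by nlinarith
  have := le_of_mul_le_mul_left h3 hb
  linarith

/-- The mean value inequality for the corrected diagonal gives the X² term; the corrections
h_{n+1}²/2 at v and at 0 account for the 1. -/
theorem abs_hermiteKernel_self_sub_le (n : ℕ) {v X : ℝ} (hv : |v| ≤ X)
    (hX : X ≤ √(2 * ((n : ℝ) + 1)) / 2) :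
    |hermiteKernel (n + 1) v v - hermiteKernel (n + 1) 0 0| ≤
      4 * (X ^ 2 + 1) / √(2 * ((n : ℝ) + 1)) := by
  have hX0 : 0 ≤ X := (abs_nonneg v).trans hv
  have hb : 0 < √(2 * ((n : ℝ) + 1)) := by positivity
  have hd := hasDerivAt_hermiteKernel_self n
  have hmv := (convex_Icc (-X) X).norm_image_sub_le_of_norm_hasDerivWithin_le
    (f := fun v => hermiteKernel (n + 1) v v + hermiteFun (n + 1) v ^ 2 / 2)
    (C := X * (4 / √(2 * ((n : ℝ) + 1))))
    (fun x _ => (hd x).hasDerivWithinAt) (by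
      intro x hx
      have hx' : |x| ≤ X := abs_le.2 hx
      rw [Real.norm_eq_abs, abs_mul, abs_neg, abs_of_nonneg (sq_nonneg (hermiteFun (n + 1) x))]
      gcongr
      have := hermiteFun_sq_add_sq_le n (hx'.trans hX)
      nlinarith [sq_nonneg (hermiteFun n x)])
    (show (0 : ℝ) ∈ _ from ⟨by linarith, hX0⟩) (show v ∈ _ from abs_le.1 hv)
  simp only [Real.norm_eq_abs, sub_zero] at hmv
  have hmv' := hmv.trans (mul_le_mul_of_nonneg_left hv (by positivity))
  have p1 := hermiteFun_sq_add_sq_le n (hv.trans hX)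
  have p2 := hermiteFun_sq_add_sq_le n (v := 0) (by rw [abs_zero]; positivity)
  have e : 4 * (X ^ 2 + 1) / √(2 * ((n : ℝ) + 1)) =
      X * (4 / √(2 * ((n : ℝ) + 1))) * X + 4 / √(2 * ((n : ℝ) + 1)) := by ring
  rw [e]
  rw [abs_le] at hmv' ⊢
  constructor <;> nlinarith [sq_nonneg (hermiteFun n v), sq_nonneg (hermiteFun (n + 1) v),
    sq_nonneg (hermiteFun n 0), sq_nonneg (hermiteFun (n + 1) 0)]

/-! ### Comparison with the sine kernel by variation of constants. -/

/-- The numerator `h_{n+1}(t) h_n(v) - h_n(t) h_{n+1}(v)` of the Christoffel–Darboux formula is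
compared with a sine wave by the variation of constants formula. -/
theorem abs_hermite_wronskian_sub_le (n : ℕ) {u v X ω : ℝ} (hu : |u| ≤ X) (hv : |v| ≤ X)
    (hX : X ≤ √(2 * ((n : ℝ) + 1)) / 2) (hω1 : 2 * (n : ℝ) ≤ ω ^ 2)
    (hω2 : ω ^ 2 ≤ 2 * (n + 1)) :
    |ω * (hermiteFun (n + 1) u * hermiteFun n v - hermiteFun n u * hermiteFun (n + 1) v) -
      2 / √(2 * ((n : ℝ) + 1)) * hermiteKernel (n + 1) v v * Real.sin (ω * (u - v))| ≤
      (X ^ 2 + 3) * (4 / √(2 * ((n : ℝ) + 1))) * |u - v| := by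
  have s1 : √(2 * ((n : ℝ) + 1)) ^ 2 = 2 * ((n : ℝ) + 1) := Real.sq_sqrt (by positivity)
  have hb : 0 < √(2 * ((n : ℝ) + 1)) := by positivity
  have hdiag := hermiteKernel_self n v
  have hp := hasDerivAt_hermiteFun_succ n
  have hq := hasDerivAt_hermiteFun n
  have hbd : ∀ t, |t| ≤ X → _ := fun t ht => hermiteFun_sq_add_sq_le n (v := t) (ht.trans hX)
  set b := √(2 * ((n : ℝ) + 1))
  set p := hermiteFun (n + 1)
  set q := hermiteFun n
  -- Z(t) = p(t)q(v) - q(t)p(v) satisfies Z(v) = 0 and Z'(v) = (2/b) times the diagonal kernel at v.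
  have hZ : ∀ t, HasDerivAt (fun t => p t * q v - q t * p v)
      ((b * q t - t * p t) * q v - (t * q t - b * p t) * p v) t := fun t =>
    ((hp t).mul_const _).sub ((hq t).mul_const _)
  have hZ' : ∀ t, HasDerivAt (fun t => (b * q t - t * p t) * q v - (t * q t - b * p t) * p v)
      ((t ^ 2 - b ^ 2 - 1) * p t * q v - (t ^ 2 - b ^ 2 + 1) * q t * p v) t := fun t => by
    have h := ((((hq t).const_mul b).sub ((hasDerivAt_id t).mul (hp t))).mul_const (q v)).sub
      ((((hasDerivAt_id t).mul (hq t)).sub ((hp t).const_mul b)).mul_const (p v))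
    refine h.congr_deriv ?_
    simp
    ring
  have hs : ∀ t, HasDerivAt (fun t => Real.sin (ω * (u - t))) (Real.cos (ω * (u - t)) * (-ω)) t :=
    fun t => by
      have h := (((hasDerivAt_id t).const_sub u).const_mul ω).sin
      refine h.congr_deriv ?_
      simp
  have hc : ∀ t, HasDerivAt (fun t => Real.cos (ω * (u - t))) (Real.sin (ω * (u - t)) * ω) t :=
    fun t => by
      have h := (((hasDerivAt_id t).const_sub u).const_mul ω).cos
      refine h.congr_deriv ?_
      simp
  -- J = ωZ cos(ω(u-t)) + Z' sin(ω(u-t)) has J(u) = ωZ(u), J(v) = Z'(v) sin(ω(u-v)) and J' = (Z'' +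
  -- ω²Z) sin(ω(u-t)).
  have hJ : ∀ t, HasDerivAt (fun t => ω * ((p t * q v - q t * p v) * Real.cos (ω * (u - t))) +
      ((b * q t - t * p t) * q v - (t * q t - b * p t) * p v) * Real.sin (ω * (u - t)))
      (Real.sin (ω * (u - t)) * ((t ^ 2 - b ^ 2 - 1 + ω ^ 2) * (p t * q v) -
        (t ^ 2 - b ^ 2 + 1 + ω ^ 2) * (q t * p v))) t := fun t => by
    have h := (((hZ t).mul (hc t)).const_mul ω).add ((hZ' t).mul (hs t))
    refine h.congr_deriv ?_
    ring
  have hmv := (convex_Icc (-X) X).norm_image_sub_le_of_norm_hasDerivWithin_le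
    (C := (X ^ 2 + 3) * (4 / b)) (fun x _ => (hJ x).hasDerivWithinAt) (by
      intro t ht
      have ht' : |t| ≤ X := abs_le.2 ht
      have h1 := hbd t ht'
      have h2 := hbd v hv
      have ht2 : t ^ 2 ≤ X ^ 2 := sq_le_sq' ht.1 ht.2
      -- Since b² = 2n+2, the window 2n ≤ ω² ≤ 2n+2 leaves only t² plus a constant between -3 and 1
      -- in both coefficients.
      have a1 : |t ^ 2 - b ^ 2 - 1 + ω ^ 2| ≤ X ^ 2 + 3 := by
        rw [s1, abs_le]; constructor <;> nlinarith [sq_nonneg t, sq_nonneg X]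
      have a2 : |t ^ 2 - b ^ 2 + 1 + ω ^ 2| ≤ X ^ 2 + 3 := by
        rw [s1, abs_le]; constructor <;> nlinarith [sq_nonneg t, sq_nonneg X]
      have a3 : |p t * q v| ≤ (p t ^ 2 + q v ^ 2) / 2 := by
        rw [abs_le]; constructor <;> nlinarith [sq_nonneg (p t + q v), sq_nonneg (p t - q v)]
      have a4 : |q t * p v| ≤ (q t ^ 2 + p v ^ 2) / 2 := by
        rw [abs_le]; constructor <;> nlinarith [sq_nonneg (q t + p v), sq_nonneg (q t - p v)]
      rw [Real.norm_eq_abs, abs_mul]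
      calc _ ≤ 1 * |(t ^ 2 - b ^ 2 - 1 + ω ^ 2) * (p t * q v) -
            (t ^ 2 - b ^ 2 + 1 + ω ^ 2) * (q t * p v)| := by
            gcongr; exact Real.abs_sin_le_one _
        _ ≤ |(t ^ 2 - b ^ 2 - 1 + ω ^ 2)| * |p t * q v| +
            |(t ^ 2 - b ^ 2 + 1 + ω ^ 2)| * |q t * p v| := by
            rw [one_mul, ← abs_mul, ← abs_mul]; exact abs_sub _ _
        _ ≤ (X ^ 2 + 3) * ((p t ^ 2 + q v ^ 2) / 2) + (X ^ 2 + 3) * ((q t ^ 2 + p v ^ 2) / 2) := by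
            gcongr
        _ = (X ^ 2 + 3) * ((p t ^ 2 + q t ^ 2 + (p v ^ 2 + q v ^ 2)) / 2) := by ring
        _ ≤ (X ^ 2 + 3) * (4 / b) := mul_le_mul_of_nonneg_left (by linarith) (by positivity))
    (show v ∈ _ from abs_le.1 hv) (show u ∈ _ from abs_le.1 hu)
  simp only [Real.norm_eq_abs, sub_self, mul_zero, Real.cos_zero, Real.sin_zero, mul_one,
    add_zero] at hmv
  convert hmv using 2
  rw [hdiag]
  field_simp
  ring

/-- The factor |u-v| in the bound for the numerator cancels the Christoffel–Darboux denominator, so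
the error is uniform up to the diagonal. The amplitude, the kernel at (v,v), is then moved to (0,0)
and compared with ω/π. The window for ω², rather than one value, admits non-integral N. -/
theorem hermiteKernel_sub_sinc_le (n : ℕ) {u v X ω : ℝ} (hu : |u| ≤ X) (hv : |v| ≤ X)
    (hX : X ≤ √(2 * ((n : ℝ) + 1)) / 2) (hω : 0 < ω) (hω1 : 2 * (n : ℝ) ≤ ω ^ 2)
    (hω2 : ω ^ 2 ≤ 2 * (n + 1)) :
    |hermiteKernel (n + 1) u v - ω / Real.pi * Real.sinc (ω * (u - v))| ≤
      (6 * X ^ 2 + 14) / ω := by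
  have s1 : √(2 * ((n : ℝ) + 1)) ^ 2 = 2 * ((n : ℝ) + 1) := Real.sq_sqrt (by positivity)
  have hb : 0 < √(2 * ((n : ℝ) + 1)) := by positivity
  have hωb : ω ≤ √(2 * ((n : ℝ) + 1)) := Real.le_sqrt_of_sq_le hω2
  have hpi := Real.pi_gt_three
  have h1 : |hermiteKernel (n + 1) u v - hermiteKernel (n + 1) v v * Real.sinc (ω * (u - v))| ≤
      (2 * X ^ 2 + 6) / ω := by
    rcases eq_or_ne u v with rfl | huv
    · simp; positivity
    · have h := abs_hermite_wronskian_sub_le n hu hv hX hω1 hω2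
      have hcd := sub_mul_hermiteKernel n u v
      have huv' : u - v ≠ 0 := sub_ne_zero.2 huv
      rw [Real.sinc_of_ne_zero (by positivity)]
      set b := √(2 * ((n : ℝ) + 1))
      have e : hermiteKernel (n + 1) u v - hermiteKernel (n + 1) v v *
          (Real.sin (ω * (u - v)) / (ω * (u - v))) = (ω * (hermiteFun (n + 1) u * hermiteFun n v -
            hermiteFun n u * hermiteFun (n + 1) v) -
          2 / b * hermiteKernel (n + 1) v v * Real.sin (ω * (u - v))) * (b / (2 * ω * (u - v))) := by
        field_simp
        linear_combination 2 * ω * hcd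
      rw [e, abs_mul, abs_div, abs_mul, abs_of_pos hb, abs_of_pos (show 0 < 2 * ω by positivity)]
      calc _ ≤ (X ^ 2 + 3) * (4 / b) * |u - v| * (b / (2 * ω * |u - v|)) := by gcongr
        _ = (2 * X ^ 2 + 6) / ω := by
          have : |u - v| ≠ 0 := abs_ne_zero.2 huv'
          field_simp
          ring
  have h2 := abs_hermiteKernel_self_sub_le n hv hX
  have h3 : |hermiteKernel (n + 1) 0 0 - ω / Real.pi| ≤ 4 / ω := by
    have h4 := abs_hermiteKernel_zero_sq_sub_le n
    have hE := hermiteKernel_self_nonneg (n + 1) 0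
    have h5 : |hermiteKernel (n + 1) 0 0 ^ 2 - (ω / Real.pi) ^ 2| ≤ 4 / Real.pi ^ 2 := by
      have : (ω / Real.pi) ^ 2 = ω ^ 2 / Real.pi ^ 2 := div_pow _ _ _
      have h6 : |2 * ((n : ℝ) + 1) / Real.pi ^ 2 - ω ^ 2 / Real.pi ^ 2| ≤ 2 / Real.pi ^ 2 := by
        rw [← sub_div, abs_div, abs_of_pos (show 0 < Real.pi ^ 2 by positivity)]
        gcongr
        rw [abs_le]; constructor <;> linarith
      rw [this]
      calc _ ≤ _ := abs_sub_le _ (2 * ((n : ℝ) + 1) / Real.pi ^ 2) _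
        _ ≤ 2 / Real.pi ^ 2 + 2 / Real.pi ^ 2 := add_le_add h4 h6
        _ = _ := by ring
    have hpos : 0 < hermiteKernel (n + 1) 0 0 + ω / Real.pi := by positivity
    rw [sq_sub_sq, abs_mul, abs_of_pos hpos] at h5
    have h7 : ω / Real.pi * |hermiteKernel (n + 1) 0 0 - ω / Real.pi| ≤ 4 / Real.pi ^ 2 := by
      refine le_trans ?_ h5
      gcongr
      linarith
    rw [le_div_iff₀ hω]
    rw [div_mul_eq_mul_div, div_le_div_iff₀ (by positivity) (by positivity)] at h7
    have h8 : Real.pi * (|hermiteKernel (n + 1) 0 0 - ω / Real.pi| * ω * Real.pi) ≤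
      Real.pi * 4 := by nlinarith
    have h9 := le_of_mul_le_mul_left h8 Real.pi_pos
    have h10 : 0 ≤ |hermiteKernel (n + 1) 0 0 - ω / Real.pi| * ω := by positivity
    nlinarith
  have h2' : |hermiteKernel (n + 1) v v - hermiteKernel (n + 1) 0 0| ≤ (4 * X ^ 2 + 4) / ω := by
    refine h2.trans ?_
    rw [show 4 * (X ^ 2 + 1) = 4 * X ^ 2 + 4 by ring]
    gcongr
  have h4 : |(hermiteKernel (n + 1) v v - ω / Real.pi) * Real.sinc (ω * (u - v))| ≤
      (4 * X ^ 2 + 8) / ω := by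
    rw [abs_mul]
    calc _ ≤ |hermiteKernel (n + 1) v v - ω / Real.pi| * 1 := by
          gcongr; exact Real.abs_sinc_le_one _
      _ ≤ |hermiteKernel (n + 1) v v - hermiteKernel (n + 1) 0 0| +
          |hermiteKernel (n + 1) 0 0 - ω / Real.pi| := by rw [mul_one]; exact abs_sub_le _ _ _
      _ ≤ (4 * X ^ 2 + 4) / ω + 4 / ω := add_le_add h2' h3
      _ = _ := by ring
  calc _ = |(hermiteKernel (n + 1) u v - hermiteKernel (n + 1) v v * Real.sinc (ω * (u - v))) +
        (hermiteKernel (n + 1) v v - ω / Real.pi) * Real.sinc (ω * (u - v))| := by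
        congr 1; ring
    _ ≤ _ := abs_add_le _ _
    _ ≤ (2 * X ^ 2 + 6) / ω + (4 * X ^ 2 + 8) / ω := add_le_add h1 h4
    _ = _ := by ring

/-! ### Exponential tails of the shape. -/

theorem tendsto_zero_of_antitone_of_integrableOn {g : ℝ → ℝ} (hg : Antitone g)
    (h0 : ∀ x, 0 ≤ g x) (hi : IntegrableOn g (Set.Ioi 0)) : Tendsto g atTop (𝓝 0) := by
  set I := ∫ x in Set.Ioi 0, g x
  have hb : ∀ x, 0 < x → g x ≤ I * x⁻¹ := by
    intro x hx
    have h1 : ∫ _ in Set.Ioc 0 x, g x ≤ ∫ t in Set.Ioc 0 x, g t := by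
      apply setIntegral_mono_on (integrableOn_const (by simp))
        (hi.mono_set Set.Ioc_subset_Ioi_self) measurableSet_Ioc
      intro t ht
      exact hg ht.2
    have h2 : ∫ t in Set.Ioc 0 x, g t ≤ I :=
      setIntegral_mono_set hi (Eventually.of_forall h0) Set.Ioc_subset_Ioi_self.eventuallyLE
    rw [setIntegral_const] at h1
    simp [hx.le] at h1
    rw [← div_eq_mul_inv, le_div_iff₀ hx]
    linarith
  refine squeeze_zero' (Eventually.of_forall h0)
    ((eventually_gt_atTop 0).mono hb) ?_
  simpa using tendsto_inv_atTop_zero.const_mul I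

/-- The difference g(x) - e^{-cx}/c is non-decreasing on [0,∞) and tends to 0, hence is
non-positive. -/
theorem le_exp_div_of_deriv_le {g : ℝ → ℝ} (hg : Antitone g) (hd : Differentiable ℝ g)
    (h0 : ∀ x, 0 ≤ g x) (hi : IntegrableOn g (Set.Ioi 0)) {c : ℝ} (hc : 0 < c)
    (hle : ∀ x, -deriv g x ≤ Real.exp (-c * |x|)) {x : ℝ} (hx : 0 ≤ x) :
    g x ≤ Real.exp (-c * x) / c := by
  have hde : ∀ x, HasDerivAt (fun x => Real.exp (-c * x) / c) (-Real.exp (-c * x)) x := by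
    intro x
    have h := (((hasDerivAt_id x).const_mul (-c)).exp).div_const c
    refine h.congr_deriv ?_
    simp
    field_simp
  have hmono : MonotoneOn (fun x => g x - Real.exp (-c * x) / c) (Set.Ici 0) := by
    have hdF : ∀ x, HasDerivAt (fun x => g x - Real.exp (-c * x) / c)
        (deriv g x - -Real.exp (-c * x)) x := fun x => (hd x).hasDerivAt.sub (hde x)
    have hdiff : Differentiable ℝ (fun x => g x - Real.exp (-c * x) / c) :=
      fun x => (hdF x).differentiableAt
    apply monotoneOn_of_deriv_nonneg (convex_Ici 0) hdiff.continuous.continuousOn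
      hdiff.differentiableOn
    intro x hx
    rw [interior_Ici] at hx
    rw [(hdF x).deriv]
    have := hle x
    rw [abs_of_pos hx] at this
    linarith
  have hlim : Tendsto (fun x => g x - Real.exp (-c * x) / c) atTop (𝓝 (0 - 0 / c)) := by
    refine (tendsto_zero_of_antitone_of_integrableOn hg h0 hi).sub (Tendsto.div_const ?_ c)
    exact Real.tendsto_exp_atBot.comp (tendsto_id.const_mul_atTop_of_neg (neg_lt_zero.2 hc))
  have := ge_of_tendsto hlim ((eventually_ge_atTop x).mono fun y hy =>
    hmono (Set.mem_Ici.2 hx) (Set.mem_Ici.2 (hx.trans hy)) hy)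
  simpa using this

theorem IsShape.antitone {Ψ : ℝ → ℝ} (h : IsShape Ψ) : Antitone Ψ :=
  antitone_of_deriv_nonpos h.differentiable h.deriv_nonpos

theorem IsExpShape.exists_tail {Ψ : ℝ → ℝ} (h : IsExpShape Ψ) : ∃ c : ℝ, 0 < c ∧
    ∀ x, 0 ≤ x → Ψ x ≤ Real.exp (-c * x) / c ∧ 1 - Ψ (-x) ≤ Real.exp (-c * x) / c := by
  obtain ⟨c, hc, hle⟩ := h.density_le
  have hanti := h.toIsShape.antitone
  refine ⟨c, hc, fun x hx => ⟨?_, ?_⟩⟩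
  · exact le_exp_div_of_deriv_le hanti h.differentiable (fun x => (h.mem_Icc x).1)
      h.integrableOn_right hc hle hx
  · have hd : ∀ x, HasDerivAt (fun x => 1 - Ψ (-x)) (deriv Ψ (-x)) x := by
      intro x
      have h1 := ((h.differentiable (-x)).hasDerivAt.comp x (hasDerivAt_neg x)).const_sub 1
      refine h1.congr_deriv ?_
      simp
    refine le_exp_div_of_deriv_le (g := fun x => 1 - Ψ (-x)) ?_
      (fun x => (hd x).differentiableAt) (fun x => by linarith [(h.mem_Icc (-x)).2]) ?_ hc ?_ hx
    · intro a b hab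
      have := hanti (neg_le_neg hab)
      simp only
      linarith
    · have := h.integrableOn_left.comp_neg
      simpa using this
    · intro x
      rw [(hd x).deriv]
      simpa [shapeDensity] using hle (-x)

/-! ### Summation by parts with a cut-off. -/

theorem sum_Icc_int_sub (f : ℤ → ℝ) {a b : ℤ} (hab : a ≤ b + 1) :
    ∑ k ∈ Finset.Icc a b, (f k - f (k + 1)) = f a - f (b + 1) := by
  have key : ∀ n : ℤ, a ≤ n → ∑ k ∈ Finset.Ico a n, (f k - f (k + 1)) = f a - f n := by
    intro n hn
    induction n, hn using Int.leInduction with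
    | base => simp
    | succ n hn ih =>
      rw [← Finset.insert_Ico_right_eq_Ico_add_one hn, Finset.sum_insert (by simp), ih]
      ring
  rw [← key (b + 1) hab]
  congr 1

/-- The cut-off weights `∑_{|k| ≤ B, k ≥ m} (f(k) - f(k+1))`. -/
theorem sum_Icc_int_ite (f : ℤ → ℝ) (B : ℕ) (m : ℤ) :
    ∑ k ∈ Finset.Icc (-(B : ℤ)) B, (f k - f (k + 1)) * (if m ≤ k then 1 else 0) =
      f (max (-(B : ℤ)) (min m (B + 1))) - f (B + 1) := by
  simp only [mul_ite, mul_one, mul_zero]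
  rw [← Finset.sum_filter]
  have : (Finset.Icc (-(B : ℤ)) B).filter (fun k => m ≤ k) =
      Finset.Icc (max (-(B : ℤ)) (min m (B + 1))) B := by
    ext k; simp; omega
  rw [this, sum_Icc_int_sub _ (by omega)]

/-- Comparison of a shifted profile with its cut-off at distance `B`. -/
theorem abs_profile_sub_cutoff_le {ψ : ℝ → ℝ} (hψ : Antitone ψ) (h01 : ∀ x, ψ x ∈ Set.Icc (0 : ℝ) 1)
    {θ T : ℝ} (hθ : 0 ≤ θ) (hθ1 : θ ≤ 1) (B : ℕ) (hT : ψ B ≤ T) (hT' : 1 - ψ (-B) ≤ T) (m : ℤ) :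
    (m ≤ -B → |ψ (m - θ) - (ψ ((max (-(B : ℤ)) (min m (B + 1)) : ℤ)) - ψ (B + 1))| ≤ 2 * T) ∧
    (-B < m → m ≤ B → |ψ (m - θ) - (ψ ((max (-(B : ℤ)) (min m (B + 1)) : ℤ)) - ψ (B + 1))| ≤
      2 * T + (ψ (m - 1) - ψ m)) ∧
    (B < m → |ψ (m - θ) - (ψ ((max (-(B : ℤ)) (min m (B + 1)) : ℤ)) - ψ (B + 1))| ≤
      ψ (m - 1)) := by
  have hB1 : ψ (B + 1) ≤ T := (hψ (by linarith)).trans hT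
  have hB0 := (h01 (B + 1)).1
  have hm1 : ψ m ≤ ψ (m - θ) := hψ (by linarith)
  have hm2 : ψ (m - θ) ≤ ψ (m - 1) := hψ (by linarith)
  refine ⟨fun h => ?_, fun h h' => ?_, fun h => ?_⟩
  · have e : max (-(B : ℤ)) (min m (B + 1)) = -B := by omega
    have h1 : ψ (-B) ≤ ψ m := hψ (by exact_mod_cast h)
    have h2 := (h01 (m - θ)).2
    have h3 := (h01 (-B)).2
    rw [e, abs_le]; push_cast
    constructor <;> linarith
  · have e : max (-(B : ℤ)) (min m (B + 1)) = m := by omega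
    rw [e, abs_le]
    constructor <;> linarith
  · have e : max (-(B : ℤ)) (min m (B + 1)) = B + 1 := by omega
    have h2 := (h01 (m - θ)).1
    rw [e, abs_le]; push_cast
    constructor <;> linarith

theorem exp_neg_le_six_div {y : ℝ} (hy : 0 < y) : Real.exp (-y) ≤ 6 / y ^ 3 := by
  have h := Real.pow_div_factorial_le_exp y hy.le 3
  rw [Real.exp_neg, le_div_iff₀ (by positivity), inv_mul_le_iff₀ (Real.exp_pos _)]
  norm_num [Nat.factorial] at h
  linarith

theorem sqrt_two_mul_le (n : ℕ) : √(2 * ((n : ℝ) + 1)) ≤ 2 * ((n : ℝ) + 1) := by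
  have hn : (0 : ℝ) ≤ n := Nat.cast_nonneg n
  rw [Real.sqrt_le_left (by positivity)]
  nlinarith

theorem summable_profile_bound {β : ℝ} (hβ : 0 < β) (C : ℝ) :
    Summable fun j : ℕ => C * Real.exp (-β * j) * (2 * ((j : ℝ) + 1)) := by
  have h1 := Real.summable_pow_mul_exp_neg_nat_mul 1 hβ
  have h0 := Real.summable_pow_mul_exp_neg_nat_mul 0 hβ
  refine ((h1.add h0).mul_left (2 * C)).congr fun j => ?_
  simp; ring

theorem profile_mul_hermite_le {ψ : ℝ → ℝ} (h01 : ∀ x, ψ x ∈ Set.Icc (0 : ℝ) 1)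
    {c β : ℝ} (hβ : 0 < β) (hc : 0 < c)
    (htail : ∀ x, 0 ≤ x → ψ x ≤ Real.exp (-β * x) / c) (N u v : ℝ) (j : ℕ) :
    |ψ (j - N) * (hermiteFun j u * hermiteFun j v)| ≤
      (1 + 1 / c) * Real.exp (β * N) * Real.exp (-β * j) * (2 * ((j : ℝ) + 1)) := by
  rw [abs_mul, abs_of_nonneg (h01 _).1]
  have h1 : ψ (j - N) ≤ (1 + 1 / c) * Real.exp (β * N) * Real.exp (-β * j) := by
    rw [mul_assoc, ← Real.exp_add, show β * N + -β * j = -β * (j - N) by ring]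
    rcases le_total 0 ((j : ℝ) - N) with h | h
    · refine (htail _ h).trans ?_
      rw [div_eq_mul_one_div, mul_comm]
      gcongr; linarith
    · refine (h01 _).2.trans ?_
      have : 1 ≤ Real.exp (-β * (j - N)) := Real.one_le_exp (by nlinarith)
      have : 0 < 1 / c := by positivity
      nlinarith
  have h2 := (abs_hermiteFun_mul_le j u v).trans (sqrt_two_mul_le j)
  gcongr

theorem hermiteKernel_eq_tsum (M : ℕ) (u v : ℝ) :
    HasSum (fun j : ℕ => (if j < M then 1 else 0) * (hermiteFun j u * hermiteFun j v))
      (hermiteKernel M u v) := by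
  have h : HasSum _ _ := hasSum_sum_of_ne_finset_zero
    (L := SummationFilter.unconditional ℕ)
    (f := fun j : ℕ => (if j < M then (1 : ℝ) else 0) * (hermiteFun j u * hermiteFun j v))
    (s := Finset.range M) (fun j hj => by simp at hj; simp [not_lt.2 hj])
  convert h using 1
  refine Finset.sum_congr rfl fun j hj => ?_
  simp [Finset.mem_range.1 hj]

/-- Summation by parts: a modified kernel is a mixture of Christoffel–Darboux kernels. -/
theorem abs_tsum_profile_sub_mixture_le {ψ : ℝ → ℝ} (hψ : Antitone ψ)
    (h01 : ∀ x, ψ x ∈ Set.Icc (0 : ℝ) 1) {c β : ℝ} (hβ : 0 < β) (hc : 0 < c)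
    (htail : ∀ x, 0 ≤ x → ψ x ≤ Real.exp (-β * x) / c)
    (htail' : ∀ x, 0 ≤ x → 1 - ψ (-x) ≤ Real.exp (-β * x) / c)
    {n₀ B : ℕ} {θ κ u v : ℝ} (hθ : 0 ≤ θ) (hθ1 : θ ≤ 1) (hB : 1 ≤ B) (hκ : 0 ≤ κ)
    (hbulk : ∀ j : ℕ, n₀ < j + B → |hermiteFun j u * hermiteFun j v| ≤ κ) :
    |∑' j : ℕ, ψ (j - (n₀ + θ)) * (hermiteFun j u * hermiteFun j v) -
      ∑ k ∈ Finset.Icc (-(B : ℤ)) B, (ψ k - ψ (k + 1)) *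
        hermiteKernel (n₀ + 1 + k).toNat u v| ≤
      κ + Real.exp (-β * B / 2) / c * (4 * ((n₀ : ℝ) + B + 1) ^ 3 +
        96 * ((n₀ : ℝ) + 3) ^ 3 / β ^ 3) * ∑' j : ℕ, 1 / ((j : ℝ) + 1) ^ 2 := by
  -- Only half of the exponent goes into T. The other half, e^{-βy/2} with y = j - n₀ - 1 ≥ B, makes
  -- the terms beyond the cut-off summable.
  set T := Real.exp (-β * B / 2) / c with hT
  have hTpos : 0 < T := by positivity
  set a : ℕ → ℝ := fun j => hermiteFun j u * hermiteFun j v with ha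
  set w : ℕ → ℝ := fun j =>
    ψ ((max (-(B : ℤ)) (min ((j : ℤ) - n₀) (B + 1)) : ℤ)) - ψ (B + 1) with hw
  have hS : Summable fun j : ℕ => 1 / ((j : ℝ) + 1) ^ 2 := by
    have := (summable_nat_add_iff 1).2 (Real.summable_one_div_nat_pow.2 one_lt_two)
    simpa using this
  have hsum1 : Summable fun j : ℕ => ψ (j - (n₀ + θ)) * a j :=
    Summable.of_norm_bounded (summable_profile_bound hβ _)
      fun j => profile_mul_hermite_le h01 hβ hc htail _ u v j
  have hsum2 : HasSum (fun j => w j * a j) (∑ k ∈ Finset.Icc (-(B : ℤ)) B,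
      (ψ k - ψ (k + 1)) * hermiteKernel (n₀ + 1 + k).toNat u v) := by
    have h := hasSum_sum (s := Finset.Icc (-(B : ℤ)) B) (fun k _ =>
      (hermiteKernel_eq_tsum (n₀ + 1 + k).toNat u v).mul_left (ψ k - ψ (k + 1)))
    refine h.congr_fun fun j => ?_
    simp only [hw]
    have e := sum_Icc_int_ite (fun k => ψ k) B ((j : ℤ) - n₀)
    push_cast at e
    push_cast
    rw [← e, Finset.sum_mul]
    refine Finset.sum_congr rfl fun k _ => ?_
    -- Order n₀+1+k means the indices j ≤ n₀+k; if it is negative, `toNat` gives the empty kernel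
    -- and both sides are false.
    have : (j < ((n₀ : ℤ) + 1 + k).toNat) ↔ ((j : ℤ) - n₀ ≤ k) := by omega
    simp only [this, ha, mul_assoc]
  -- The cost of replacing the shift θ by an integer one. These costs telescope to at most 1, so
  -- rounding N contributes only one factor κ.
  set R : ℕ → ℝ := fun j => ψ ((j : ℝ) - n₀ - 1) - ψ (j - n₀) with hR
  have hR0 : ∀ j, 0 ≤ R j := fun j => sub_nonneg.2 (hψ (by linarith))
  have hRsum : ∀ n, ∑ j ∈ Finset.range n, R j ≤ 1 := by
    intro n
    have : ∀ n : ℕ, ∑ j ∈ Finset.range n, R j = ψ (0 - n₀ - 1) - ψ (n - n₀ - 1) := by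
      intro n
      induction n with
      | zero => simp
      | succ n ih =>
        rw [Finset.sum_range_succ, ih]
        push_cast
        rw [show (n : ℝ) + 1 - n₀ - 1 = n - n₀ by ring]
        simp only [hR]; ring
    rw [this]
    linarith [(h01 (0 - n₀ - 1)).2, (h01 (n - n₀ - 1)).1]
  have hRs : Summable R := summable_of_sum_range_le hR0 hRsum
  have hRt : ∑' j, R j ≤ 1 := hRs.tsum_le_of_sum_range_le hRsum
  -- The first summand serves the indices up to n₀+B, the second those beyond; the cubes leave room
  -- for the summable factor 1/(j+1)².
  set Q := 4 * ((n₀ : ℝ) + B + 1) ^ 3 + 96 * ((n₀ : ℝ) + 3) ^ 3 / β ^ 3 with hQ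
  have hB' : (1 : ℝ) ≤ B := by exact_mod_cast hB
  have hTB : Real.exp (-β * B) / c ≤ T := by
    rw [hT]; gcongr; nlinarith
  have hterm : ∀ j : ℕ, |(ψ (j - (n₀ + θ)) - w j) * a j| ≤
      κ * R j + T * Q * (1 / ((j : ℝ) + 1) ^ 2) := by
    intro j
    obtain ⟨c1, c2, c3⟩ := abs_profile_sub_cutoff_le hψ h01 hθ hθ1 B
      ((htail B (by positivity)).trans hTB) ((htail' B (by positivity)).trans hTB) ((j : ℤ) - n₀)
    push_cast at c1 c2 c3
    have e : (j : ℝ) - (n₀ + θ) = j - n₀ - θ := by ring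
    have ha1 : |a j| ≤ 2 * ((j : ℝ) + 1) := (abs_hermiteFun_mul_le j u v).trans (sqrt_two_mul_le j)
    have hj : (0 : ℝ) ≤ j := Nat.cast_nonneg j
    have hn : (0 : ℝ) ≤ n₀ := Nat.cast_nonneg n₀
    have hlow : j ≤ n₀ + B → 2 * T * |a j| ≤ T * Q * (1 / ((j : ℝ) + 1) ^ 2) := by
      intro h
      have h' : (j : ℝ) ≤ n₀ + B := by exact_mod_cast h
      calc 2 * T * |a j| ≤ 2 * T * (2 * ((j : ℝ) + 1)) := by gcongr
        _ = T * (4 * ((j : ℝ) + 1) ^ 3) * (1 / ((j : ℝ) + 1) ^ 2) := by field_simp; ring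
        _ ≤ T * Q * (1 / ((j : ℝ) + 1) ^ 2) := by
          gcongr
          rw [hQ]
          have : 4 * ((j : ℝ) + 1) ^ 3 ≤ 4 * ((n₀ : ℝ) + B + 1) ^ 3 := by gcongr
          have : 0 ≤ 96 * ((n₀ : ℝ) + 3) ^ 3 / β ^ 3 := by positivity
          linarith
    have hκR : 0 ≤ κ * R j := mul_nonneg hκ (hR0 j)
    rw [abs_mul, e]
    simp only [hw]
    push_cast
    rcases le_or_gt ((j : ℤ) - n₀) (-B) with h | h
    · calc _ ≤ 2 * T * |a j| := by gcongr; exact c1 h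
        _ ≤ _ := (hlow (by omega)).trans (le_add_of_nonneg_left hκR)
    · rcases le_or_gt ((j : ℤ) - n₀) B with h' | h'
      · calc _ ≤ (2 * T + R j) * |a j| := by gcongr; exact c2 h h'
          _ = R j * |a j| + 2 * T * |a j| := by ring
          _ ≤ R j * κ + T * Q * (1 / ((j : ℝ) + 1) ^ 2) :=
            add_le_add (mul_le_mul_of_nonneg_left (hbulk j (by omega)) (hR0 j)) (hlow (by omega))
          _ = _ := by ring
      · have hm : (B : ℝ) + 1 ≤ j - n₀ := by
          have : (B : ℤ) + 1 ≤ j - n₀ := by omega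
          exact_mod_cast this
        set y := (j : ℝ) - n₀ - 1 with hy
        have hy1 : 1 ≤ y := by linarith
        have hψy : ψ y ≤ T * (48 / (β ^ 3 * y ^ 3)) := by
          calc ψ y ≤ Real.exp (-β * y) / c := htail y (by linarith)
            _ ≤ (Real.exp (-β * B / 2) * Real.exp (-(β * y / 2))) / c := by
              rw [← Real.exp_add]; gcongr; nlinarith
            _ ≤ (Real.exp (-β * B / 2) * (6 / (β * y / 2) ^ 3)) / c := by
              gcongr; exact exp_neg_le_six_div (by positivity)
            _ = _ := by rw [hT]; field_simp; norm_num
        have hjy : (j : ℝ) + 1 ≤ (n₀ + 3) * y := by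
          rw [show (j : ℝ) + 1 = n₀ + 2 + y by rw [hy]; ring]
          nlinarith
        calc _ ≤ (T * (48 / (β ^ 3 * y ^ 3))) * (2 * ((j : ℝ) + 1)) := by
              gcongr; exact (c3 h').trans hψy
          _ = T * (96 / β ^ 3) * (((j : ℝ) + 1) ^ 3 / y ^ 3) * (1 / ((j : ℝ) + 1) ^ 2) := by
              field_simp; ring
          _ ≤ T * (96 / β ^ 3) * (((n₀ + 3) * y) ^ 3 / y ^ 3) * (1 / ((j : ℝ) + 1) ^ 2) := by
              gcongr
          _ = T * (96 * ((n₀ : ℝ) + 3) ^ 3 / β ^ 3) * (1 / ((j : ℝ) + 1) ^ 2) := by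
              field_simp
          _ ≤ T * Q * (1 / ((j : ℝ) + 1) ^ 2) := by
              gcongr
              rw [hQ]
              have : 0 ≤ 4 * ((n₀ : ℝ) + B + 1) ^ 3 := by positivity
              linarith
          _ ≤ _ := le_add_of_nonneg_left hκR
  rw [← hsum2.tsum_eq, ← hsum1.tsum_sub hsum2.summable]
  have hbd := (hRs.mul_left κ).add (hS.mul_left (T * Q))
  have hfin := tsum_of_norm_bounded hbd.hasSum (f := fun j : ℕ => ψ (j - (n₀ + θ)) * a j - w j * a j)
    (fun j => by rw [← sub_mul]; exact hterm j)
  refine hfin.trans ?_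
  rw [(hRs.mul_left κ).tsum_add (hS.mul_left (T * Q)), tsum_mul_left, tsum_mul_left]
  gcongr
  exact mul_le_of_le_one_right hκ hRt

/-! ### Rescaling and the uniform estimate for the two kernels. -/

/-- The factor between the scale of the Hermite functions and the modification scale. -/
noncomputable def hermiteScale (α N : ℝ) : ℝ := Real.pi * √N / √2 * N ^ (-α)

theorem hermiteScale_pos (α : ℝ) {N : ℝ} (hN : 0 < N) : 0 < hermiteScale α N := by
  unfold hermiteScale
  have := Real.rpow_pos_of_pos hN (-α)
  positivity

theorem modifiedGUETerm_eq (Ψ : ℝ → ℝ) (τ α N x y : ℝ) (k : ℕ) :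
    modifiedGUETerm Ψ τ α N x y k = Real.pi * √N / √2 * (Ψ (((k : ℝ) - N) / (τ * N ^ α)) *
      (hermiteFun k (x * (Real.pi * √N / √2)) * hermiteFun k (y * (Real.pi * √N / √2)))) := by
  have h : √(Real.pi * √N / √2) ^ 2 = Real.pi * √N / √2 := Real.sq_sqrt (by positivity)
  unfold modifiedGUETerm rescaledHermite
  linear_combination (Ψ (((k : ℝ) - N) / (τ * N ^ α)) * (hermiteFun k (x * (Real.pi * √N / √2)) *
    hermiteFun k (y * (Real.pi * √N / √2)))) * h

theorem criticalModifiedGUEKernel_eq (Ψ : ℝ → ℝ) (τ α N x y : ℝ) :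
    criticalModifiedGUEKernel Ψ τ α N x y = hermiteScale α N *
      ∑' j : ℕ, Ψ (((j : ℝ) - N) / (τ * N ^ α)) *
        (hermiteFun j (hermiteScale α N * x) * hermiteFun j (hermiteScale α N * y)) := by
  have e : ∀ x, x * N ^ (-α) * (Real.pi * √N / √2) = hermiteScale α N * x := by
    intro x; unfold hermiteScale; ring
  unfold criticalModifiedGUEKernel modifiedGUEKernel
  simp only [modifiedGUETerm_eq, e]
  rw [tsum_mul_left, ← mul_assoc]
  congr 1
  unfold hermiteScale; ring

theorem sineFun_eq_sinc (η u : ℝ) :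
    sineFun η u = 2 * η * Real.sinc (2 * Real.pi * η * u) := by
  unfold sineFun
  split_ifs with h
  · simp [h]
  · rcases eq_or_ne η 0 with rfl | hη
    · simp
    · have := Real.pi_pos
      rw [Real.sinc_of_ne_zero (by positivity)]
      field_simp

theorem criticalSineMixtureKernel_eq {Ψ : ℝ → ℝ} {τ α : ℝ} {ξ : ℝ → ℤ → ℝ} {N : ℝ} (hN : 0 < N)
    (hξ : ∀ k : ℤ, IsMeanValuePoint Ψ τ α N k (ξ N k)) (x y : ℝ) :
    criticalSineMixtureKernel Ψ τ α ξ N x y =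
      ∑ k ∈ Finset.Icc (-(⌊Real.log N ^ 2 * N ^ α⌋₊ : ℤ)) ⌊Real.log N ^ 2 * N ^ α⌋₊,
        (Ψ ((k : ℝ) / (τ * N ^ α)) - Ψ (((k : ℝ) + 1) / (τ * N ^ α))) *
          sineFun (N ^ (1 - α) * √(1 + (k : ℝ) / N) / 2) (x - y) := by
  unfold criticalSineMixtureKernel sineMixtureKernel
  rw [Finset.mul_sum, Int.natCast_floor_eq_floor (by positivity)]
  refine Finset.sum_congr rfl fun k _ => ?_
  rw [← (hξ k).2]; ring

/-- In Hermite coordinates the frequency 2πη(k) becomes √(2(N+k)), the ω of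
`hermiteKernel_sub_sinc_le`. -/
theorem sineFun_eq_hermiteScale {α N : ℝ} (hN : 0 < N) (k : ℤ) (x y : ℝ) :
    sineFun (N ^ (1 - α) * √(1 + (k : ℝ) / N) / 2) (x - y) = hermiteScale α N *
      (√(2 * (N + k)) / Real.pi *
        Real.sinc (√(2 * (N + k)) * (hermiteScale α N * x - hermiteScale α N * y))) := by
  have h1 : Real.pi * (N ^ (1 - α) * √(1 + (k : ℝ) / N)) = √(2 * (N + k)) * hermiteScale α N := by
    have e : 1 + (k : ℝ) / N = (N + k) / N := by field_simp
    have hs : √N ^ 2 = N := Real.sq_sqrt hN.le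
    have hsp : 0 < √N := Real.sqrt_pos.2 hN
    rw [e, Real.sqrt_div' _ hN.le, Real.sqrt_mul zero_le_two, sub_eq_add_neg, Real.rpow_add hN,
      Real.rpow_one, hermiteScale]
    field_simp
    rw [hs, mul_comm]
  have hpi := Real.pi_pos
  have h2 : N ^ (1 - α) * √(1 + (k : ℝ) / N) = √(2 * (N + k)) * hermiteScale α N / Real.pi := by
    rw [← h1]; field_simp
  rw [sineFun_eq_sinc, h2]
  rw [show 2 * Real.pi * (√(2 * (N + k)) * hermiteScale α N / Real.pi / 2) * (x - y) =
    √(2 * (N + k)) * (hermiteScale α N * x - hermiteScale α N * y) by field_simp]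
  ring

theorem critical_kernels_sub_le {Ψ : ℝ → ℝ} (hΨ : IsExpShape Ψ) {c : ℝ} (hc : 0 < c)
    (htail : ∀ x, 0 ≤ x → Ψ x ≤ Real.exp (-c * x) / c ∧ 1 - Ψ (-x) ≤ Real.exp (-c * x) / c)
    {τ α : ℝ} (hτ : 0 < τ) {ξ : ℝ → ℤ → ℝ} {N : ℝ} (hN : 0 < N)
    (hξ : ∀ k : ℤ, IsMeanValuePoint Ψ τ α N k (ξ N k)) {B : ℕ}
    (hBdef : B = ⌊Real.log N ^ 2 * N ^ α⌋₊) (hB : 1 ≤ B) (hBN : (B : ℝ) + 1 ≤ N / 2)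
    {A : ℝ} (hA : hermiteScale α N * A ≤ √N / 2) {x y : ℝ} (hx : |x| ≤ A) (hy : |y| ≤ A) :
    |criticalModifiedGUEKernel Ψ τ α N x y - criticalSineMixtureKernel Ψ τ α ξ N x y| ≤
      hermiteScale α N * ((6 * (hermiteScale α N * A) ^ 2 + 18) / √N +
        Real.exp (-(c / (τ * N ^ α)) * B / 2) / c * (4 * (N + B + 1) ^ 3 +
          96 * (N + 3) ^ 3 / (c / (τ * N ^ α)) ^ 3) * ∑' j : ℕ, 1 / ((j : ℝ) + 1) ^ 2) := by
  set s := hermiteScale α N with hs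
  have hs0 : 0 < s := hermiteScale_pos α hN
  have hσ : 0 < τ * N ^ α := mul_pos hτ (Real.rpow_pos_of_pos hN α)
  set σ := τ * N ^ α with hσdef
  have hN0 : (⌊N⌋₊ : ℝ) ≤ N := Nat.floor_le hN.le
  have hN1 : N < ⌊N⌋₊ + 1 := Nat.lt_floor_add_one N
  set n₀ := ⌊N⌋₊ with hn₀
  have hsN : 0 < √N := Real.sqrt_pos.2 hN
  have hX : ∀ z, |z| ≤ A → |s * z| ≤ s * A := fun z hz => by
    rw [abs_mul, abs_of_pos hs0]; gcongr
  set X := s * A with hXdef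
  set ψ : ℝ → ℝ := fun t => Ψ (t / σ) with hψ
  have hanti : Antitone ψ := fun a b hab => hΨ.toIsShape.antitone (by gcongr)
  have hbulk' : ∀ j : ℕ, n₀ < j + B + 1 → √N / 2 ≤ √(2 * ((j : ℝ) + 1)) / 2 := by
    intro j hj
    have : (n₀ : ℝ) + 1 ≤ j + B + 1 := by exact_mod_cast hj
    gcongr
    linarith
  have hmain := abs_tsum_profile_sub_mixture_le (ψ := ψ) hanti (fun x => hΨ.mem_Icc _)
    (div_pos hc hσ) hc
    (fun x hx => by
      have := (htail (x / σ) (by positivity)).1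
      rwa [show -c * (x / σ) = -(c / σ) * x by ring] at this)
    (fun x hx => by
      have := (htail (x / σ) (by positivity)).2
      rwa [show -c * (x / σ) = -(c / σ) * x by ring, ← neg_div] at this)
    (n₀ := n₀) (B := B) (θ := N - n₀) (κ := 4 / √N) (u := s * x) (v := s * y)
    (by linarith) (by linarith) hB (by positivity) (fun j hj => by
      have h1 := hbulk' j (by omega)
      have h2 := hermiteFun_sq_add_sq_le j (((hX x hx).trans hA).trans h1)
      have h3 := hermiteFun_sq_add_sq_le j (((hX y hy).trans hA).trans h1)
      have h4 : 4 / √(2 * ((j : ℝ) + 1)) ≤ 4 / √N :=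
        div_le_div_of_nonneg_left (by norm_num) hsN (by linarith)
      rw [abs_le]
      constructor <;> nlinarith [sq_nonneg (hermiteFun j (s * x) + hermiteFun j (s * y)),
        sq_nonneg (hermiteFun j (s * x) - hermiteFun j (s * y)),
        sq_nonneg (hermiteFun (j + 1) (s * x)), sq_nonneg (hermiteFun (j + 1) (s * y))])
  have hK : criticalModifiedGUEKernel Ψ τ α N x y = s * ∑' j : ℕ, ψ (j - (n₀ + (N - n₀))) *
      (hermiteFun j (s * x) * hermiteFun j (s * y)) := by
    rw [criticalModifiedGUEKernel_eq, add_sub_cancel]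
  rw [hK, criticalSineMixtureKernel_eq hN hξ, ← hBdef]
  simp only [sineFun_eq_hermiteScale hN]
  rw [← hs, ← hσdef]
  set S := ∑' j : ℕ, ψ (j - (n₀ + (N - n₀))) * (hermiteFun j (s * x) * hermiteFun j (s * y))
  have hq0 : ∀ k : ℤ, 0 ≤ ψ k - ψ (k + 1) := fun k => sub_nonneg.2 (hanti (by linarith))
  have hmix : |∑ k ∈ Finset.Icc (-(B : ℤ)) B, (ψ k - ψ (k + 1)) *
        hermiteKernel (n₀ + 1 + k).toNat (s * x) (s * y) -
      ∑ k ∈ Finset.Icc (-(B : ℤ)) B, (ψ k - ψ (k + 1)) * (√(2 * (N + k)) / Real.pi *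
        Real.sinc (√(2 * (N + k)) * (s * x - s * y)))| ≤ (6 * X ^ 2 + 14) / √N := by
    rw [← Finset.sum_sub_distrib]
    refine (Finset.abs_sum_le_sum_abs _ _).trans ?_
    calc _ ≤ ∑ k ∈ Finset.Icc (-(B : ℤ)) B, (ψ k - ψ (k + 1)) * ((6 * X ^ 2 + 14) / √N) := by
          refine Finset.sum_le_sum fun k hk => ?_
          rw [← mul_sub, abs_mul, abs_of_nonneg (hq0 k)]
          refine mul_le_mul_of_nonneg_left ?_ (hq0 k)
          rw [Finset.mem_Icc] at hk
          have hk1 : -(B : ℝ) ≤ k := by exact_mod_cast hk.1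
          have hpos : 0 < (n₀ : ℤ) + 1 + k := by
            have : (0 : ℝ) < n₀ + 1 + k := by linarith
            exact_mod_cast this
          obtain ⟨n, hn⟩ : ∃ n : ℕ, (n₀ : ℤ) + k = n := ⟨((n₀ : ℤ) + k).toNat, by omega⟩
          have hn' : (n₀ : ℝ) + k = n := by exact_mod_cast hn
          rw [show ((n₀ : ℤ) + 1 + k).toNat = n + 1 by omega]
          have hω : √(2 * (N + k)) ^ 2 = 2 * (N + k) := Real.sq_sqrt (by linarith)
          have hωN : √N ≤ √(2 * (N + k)) := Real.sqrt_le_sqrt (by linarith)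
          -- With n = ⌊N⌋ + k one has n ≤ N + k < n + 1, so ω² = 2(N+k) lies in the admissible
          -- window; B + 1 ≤ N/2 keeps ω ≥ √N.
          have h := hermiteKernel_sub_sinc_le n (hX x hx) (hX y hy)
            (hA.trans (hbulk' n (by omega))) (hsN.trans_le hωN)
            (by rw [hω]; linarith) (by rw [hω]; linarith)
          refine h.trans ?_
          gcongr
      _ = (ψ (-B) - ψ (B + 1)) * ((6 * X ^ 2 + 14) / √N) := by
          rw [← Finset.sum_mul]
          have := sum_Icc_int_sub (fun k : ℤ => ψ k) (a := -(B : ℤ)) (b := B) (by omega)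
          push_cast at this
          rw [this]
      _ ≤ 1 * ((6 * X ^ 2 + 14) / √N) := by
          gcongr
          have h1 := (hΨ.mem_Icc (-B / σ)).2
          have h2 := (hΨ.mem_Icc ((B + 1) / σ)).1
          simp only [hψ]
          linarith
      _ = _ := one_mul _
  set M := ∑ k ∈ Finset.Icc (-(B : ℤ)) B, (ψ k - ψ (k + 1)) *
        hermiteKernel (n₀ + 1 + k).toNat (s * x) (s * y)
  have e : ∑ k ∈ Finset.Icc (-(B : ℤ)) B, (Ψ (k / σ) - Ψ ((k + 1) / σ)) *
        (s * (√(2 * (N + k)) / Real.pi * Real.sinc (√(2 * (N + k)) * (s * x - s * y)))) =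
      s * ∑ k ∈ Finset.Icc (-(B : ℤ)) B, (ψ k - ψ (k + 1)) * (√(2 * (N + k)) / Real.pi *
        Real.sinc (√(2 * (N + k)) * (s * x - s * y))) := by
    rw [Finset.mul_sum]
    exact Finset.sum_congr rfl fun k _ => by simp only [hψ]; ring
  rw [e, ← mul_sub, abs_mul, abs_of_pos hs0]
  refine mul_le_mul_of_nonneg_left ?_ hs0.le
  refine (abs_sub_le _ M _).trans ((add_le_add hmain hmix).trans ?_)
  have hS0 : 0 ≤ ∑' j : ℕ, 1 / ((j : ℝ) + 1) ^ 2 := tsum_nonneg fun j => by positivity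
  have hβ : 0 < c / σ := by positivity
  calc _ ≤ 4 / √N + Real.exp (-(c / σ) * B / 2) / c * (4 * (N + B + 1) ^ 3 +
          96 * (N + 3) ^ 3 / (c / σ) ^ 3) * ∑' j : ℕ, 1 / ((j : ℝ) + 1) ^ 2 +
          (6 * X ^ 2 + 14) / √N := by gcongr
    _ = _ := by ring

theorem eventually_log_sq_mul_rpow_le {α : ℝ} (hα1 : α < 1) :
    ∀ᶠ N : ℝ in atTop, Real.log N ^ 2 * N ^ α + 1 ≤ N / 2 := by
  have h := (isLittleO_log_rpow_rpow_atTop 2 (sub_pos.2 hα1)).tendsto_div_nhds_zero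
  filter_upwards [h.eventually_lt_const (show (0 : ℝ) < 1 / 4 by norm_num),
    eventually_ge_atTop 4] with N h1 h2
  have hN : 0 < N := by linarith
  rw [div_lt_iff₀ (Real.rpow_pos_of_pos hN _), Real.rpow_two] at h1
  have h3 : N ^ (1 - α) * N ^ α = N := by
    rw [← Real.rpow_add hN, sub_add_cancel, Real.rpow_one]
  nlinarith [Real.rpow_pos_of_pos hN α]

/-- The scale is of order N^{1/2-α}, so its cube over √N is of order N^{1-3α} and the scale over √N
of order N^{-α}. A positive δ exists exactly when α > 1/3. -/
theorem hermiteScale_mul_div_le {α δ N A : ℝ} (hN : 1 ≤ N) (hδ1 : δ ≤ 3 * α - 1) (hδ2 : δ ≤ α) :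
    hermiteScale α N * ((6 * (hermiteScale α N * A) ^ 2 + 18) / √N) ≤
      (6 * A ^ 2 * (Real.pi / √2) ^ 3 + 18 * (Real.pi / √2)) * N ^ (-δ) := by
  have hN0 : 0 < N := by linarith
  have hsN : 0 < √N := Real.sqrt_pos.2 hN0
  have hs : √N ^ 2 = N := Real.sq_sqrt hN0.le
  have hpi := Real.pi_pos
  have e1 : N ^ (-α) ≤ N ^ (-δ) := Real.rpow_le_rpow_of_exponent_le hN (by linarith)
  have e2 : N * (N ^ (-α)) ^ 3 ≤ N ^ (-δ) := by
    rw [← Real.rpow_natCast (N ^ (-α)), ← Real.rpow_mul hN0.le]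
    nth_rewrite 1 [← Real.rpow_one N]
    rw [← Real.rpow_add hN0]
    exact Real.rpow_le_rpow_of_exponent_le hN (by push_cast; linarith)
  have e3 : hermiteScale α N * ((6 * (hermiteScale α N * A) ^ 2 + 18) / √N) =
      6 * A ^ 2 * (Real.pi / √2) ^ 3 * (√N ^ 2 * (N ^ (-α)) ^ 3) +
        18 * (Real.pi / √2) * N ^ (-α) := by
    unfold hermiteScale
    field_simp
  rw [e3, hs, add_mul]
  gcongr

theorem tail_polynomial_le {α τ c N B : ℝ} (hα1 : α < 1) (hα0 : 0 < α) (hτ : 0 < τ)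
    (hc : 0 < c) (hN : 1 ≤ N) (hB0 : 0 ≤ B) (hBN : B + 1 ≤ N) :
    4 * (N + B + 1) ^ 3 + 96 * (N + 3) ^ 3 / (c / (τ * N ^ α)) ^ 3 ≤
      (32 + 6144 * τ ^ 3 / c ^ 3) * N ^ 6 := by
  have hN0 : 0 < N := by linarith
  have h1 : N ^ α ≤ N := by
    nth_rewrite 2 [← Real.rpow_one N]
    exact Real.rpow_le_rpow_of_exponent_le hN hα1.le
  have hp := Real.rpow_pos_of_pos hN0 α
  have h2 : 4 * (N + B + 1) ^ 3 ≤ 32 * N ^ 6 := by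
    calc 4 * (N + B + 1) ^ 3 ≤ 4 * (2 * N) ^ 3 := by gcongr; linarith
      _ = 32 * N ^ 3 := by ring
      _ ≤ 32 * N ^ 6 := by gcongr; simp
  have h3 : 96 * (N + 3) ^ 3 / (c / (τ * N ^ α)) ^ 3 ≤ 6144 * τ ^ 3 / c ^ 3 * N ^ 6 := by
    calc 96 * (N + 3) ^ 3 / (c / (τ * N ^ α)) ^ 3 = 96 * (N + 3) ^ 3 * (τ * N ^ α) ^ 3 / c ^ 3 := by
          field_simp
      _ ≤ 96 * (4 * N) ^ 3 * (τ * N) ^ 3 / c ^ 3 := by gcongr; linarith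
      _ = _ := by ring
  linarith

theorem eventually_critical_kernels_sub_le {Ψ : ℝ → ℝ} (hΨ : IsExpShape Ψ) {α τ δ : ℝ}
    (hα1 : α < 1) (hα0 : 0 < α) (hτ : 0 < τ) (hδ1 : δ ≤ 3 * α - 1) (hδ2 : δ ≤ α)
    {ξ : ℝ → ℤ → ℝ}
    (hξ : ∀ N : ℝ, 0 < N → ∀ k : ℤ, IsMeanValuePoint Ψ τ α N k (ξ N k)) (A : ℝ) :
    ∃ C : ℝ, 0 ≤ C ∧ ∀ᶠ N : ℝ in atTop, ∀ x y : ℝ, |x| ≤ A → |y| ≤ A →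
      |criticalModifiedGUEKernel Ψ τ α N x y - criticalSineMixtureKernel Ψ τ α ξ N x y| ≤
        C * N ^ (-δ) := by
  obtain ⟨c, hc, htail⟩ := hΨ.exists_tail
  have hpi := Real.pi_pos
  set S := ∑' j : ℕ, 1 / ((j : ℝ) + 1) ^ 2 with hS
  have hS0 : 0 ≤ S := tsum_nonneg fun j => by positivity
  set C1 := 6 * A ^ 2 * (Real.pi / √2) ^ 3 + 18 * (Real.pi / √2) with hC1
  set C2 := Real.pi / √2 / c * (32 + 6144 * τ ^ 3 / c ^ 3) * S with hC2
  have hC1' : 0 ≤ C1 := by positivity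
  have hC2' : 0 ≤ C2 := by positivity
  refine ⟨C1 + C2, add_nonneg hC1' hC2', ?_⟩
  have hlog := Real.tendsto_log_atTop
  have hdecay : Tendsto (fun N : ℝ => Real.pi / √2 * A * N ^ (-α)) atTop (𝓝 0) := by
    simpa using (tendsto_rpow_neg_atTop hα0).const_mul (Real.pi / √2 * A)
  filter_upwards [eventually_ge_atTop 1, eventually_log_sq_mul_rpow_le hα1,
    hlog.eventually_ge_atTop 2, hlog.eventually_ge_atTop (32 * τ / c),
    hdecay.eventually_le_const (show (0 : ℝ) < 1 / 2 by norm_num)]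
    with N hN hlogN hl2 hlc hdec x y hx hy
  have hN0 : 0 < N := by linarith
  have hNα : 1 ≤ N ^ α := Real.one_le_rpow hN hα0.le
  set Y := Real.log N ^ 2 * N ^ α with hY
  have hl4 : 4 ≤ Real.log N ^ 2 := by nlinarith
  have hY4 : 4 ≤ Y := by nlinarith
  have hB1 : (⌊Y⌋₊ : ℝ) ≤ Y := Nat.floor_le (by linarith)
  have hB2 : Y < ⌊Y⌋₊ + 1 := Nat.lt_floor_add_one Y
  have hA' : hermiteScale α N * A ≤ √N / 2 := by
    have : hermiteScale α N * A = √N * (Real.pi / √2 * A * N ^ (-α)) := by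
      unfold hermiteScale; ring
    rw [this]
    nlinarith [Real.sqrt_nonneg N]
  have hmain := critical_kernels_sub_le hΨ hc htail hτ hN0 (hξ N hN0) (B := ⌊Y⌋₊) rfl
    (by rw [Nat.one_le_floor_iff]; linarith) (by linarith) hA' hx hy
  refine hmain.trans ?_
  set B : ℝ := (⌊Y⌋₊ : ℝ) with hB
  have hB0 : 0 ≤ B := Nat.cast_nonneg _
  -- Since B ≥ (log N)² N^α / 2, the exponent is at least c(log N)²/(4τ), hence at least 8 log N
  -- once log N ≥ 32τ/c. The power 8 beats the N⁶ of the polynomial and the N of the scale, leaving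
  -- N⁻¹.
  have hexp : Real.exp (-(c / (τ * N ^ α)) * B / 2) ≤ (N ^ 8)⁻¹ := by
    have hlogpos : 0 ≤ Real.log N := by linarith
    have e : (N ^ 8)⁻¹ = Real.exp (-(8 * Real.log N)) := by
      rw [Real.exp_neg, show (8 : ℝ) * Real.log N = Real.log (N ^ 8) by
        rw [Real.log_pow]; norm_num, Real.exp_log (by positivity)]
    rw [e, Real.exp_le_exp]
    have h1 : 8 * Real.log N * τ * N ^ α ≤ c * B / 2 := by
      have h2 : Y / 2 ≤ B := by linarith
      have h3 : 32 * τ ≤ Real.log N * c := by rwa [div_le_iff₀ hc] at hlc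
      calc 8 * Real.log N * τ * N ^ α = (32 * τ) * Real.log N * N ^ α / 4 := by ring
        _ ≤ (Real.log N * c) * Real.log N * N ^ α / 4 := by gcongr
        _ = c * (Y / 2) / 2 := by rw [hY]; ring
        _ ≤ c * B / 2 := by gcongr
    have h4 : 8 * Real.log N ≤ c / (τ * N ^ α) * B / 2 := by
      rw [div_mul_eq_mul_div, div_div, mul_comm (τ * N ^ α), ← div_div,
        le_div_iff₀ (by positivity)]
      linarith
    linarith
  rw [mul_add, add_mul]
  refine add_le_add (hermiteScale_mul_div_le hN hδ1 hδ2) ?_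
  have hQ := tail_polynomial_le hα1 hα0 hτ hc hN hB0 (by linarith : B + 1 ≤ N)
  have hscale : hermiteScale α N ≤ Real.pi / √2 * N := by
    have h1 : N ^ (-α) ≤ 1 := Real.rpow_le_one_of_one_le_of_nonpos hN (by linarith)
    have h2 : √N ≤ N := by
      rw [Real.sqrt_le_left hN0.le]; nlinarith
    have : hermiteScale α N = Real.pi / √2 * (√N * N ^ (-α)) := by unfold hermiteScale; ring
    rw [this]
    gcongr
    calc √N * N ^ (-α) ≤ N * 1 := by gcongr
      _ = N := mul_one N
  have hδN : N⁻¹ ≤ N ^ (-δ) := by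
    rw [← Real.rpow_neg_one]
    exact Real.rpow_le_rpow_of_exponent_le hN (by linarith)
  calc _ ≤ Real.pi / √2 * N * ((N ^ 8)⁻¹ / c * ((32 + 6144 * τ ^ 3 / c ^ 3) * N ^ 6) * S) := by
        gcongr
    _ = C2 * N⁻¹ := by rw [hC2]; field_simp
    _ ≤ C2 * N ^ (-δ) := by gcongr

/-! ### Convergence of the series and integrability of the traces. -/

theorem continuous_hermiteFun (n : ℕ) : Continuous (hermiteFun n) :=
  continuous_iff_continuousAt.2 fun x => (hasDerivAt_hermiteFun n x).continuousAt

/-- A majorant uniform in u and v, for the Weierstrass test: it yields both absolute convergence and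
continuity of the kernel. -/
theorem exists_profile_bound {Ψ : ℝ → ℝ} (hΨ : IsExpShape Ψ) {σ : ℝ} (hσ : 0 < σ) (N : ℝ) :
    ∃ g : ℕ → ℝ, Summable g ∧ ∀ (u v : ℝ) (j : ℕ),
      ‖Ψ (((j : ℝ) - N) / σ) * (hermiteFun j u * hermiteFun j v)‖ ≤ g j := by
  obtain ⟨c, hc, htail⟩ := hΨ.exists_tail
  refine ⟨_, summable_profile_bound (div_pos hc hσ) _, fun u v j =>
    profile_mul_hermite_le (ψ := fun t => Ψ (t / σ)) (fun x => hΨ.mem_Icc _) (div_pos hc hσ) hc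
      (fun x hx => ?_) N u v j⟩
  have := (htail (x / σ) (by positivity)).1
  rwa [show -c * (x / σ) = -(c / σ) * x by ring] at this

theorem summable_modifiedGUETerm {Ψ : ℝ → ℝ} (hΨ : IsExpShape Ψ) {τ α N : ℝ} (hτ : 0 < τ)
    (hN : 0 < N) (x y : ℝ) : Summable (modifiedGUETerm Ψ τ α N x y) := by
  obtain ⟨g, hg, hle⟩ := exists_profile_bound hΨ (mul_pos hτ (Real.rpow_pos_of_pos hN α)) N
  rw [funext fun k => modifiedGUETerm_eq Ψ τ α N x y k]
  exact (Summable.of_norm_bounded hg (hle _ _)).mul_left _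

theorem continuous_criticalModifiedGUEKernel {Ψ : ℝ → ℝ} (hΨ : IsExpShape Ψ) {τ α N : ℝ}
    (hτ : 0 < τ) (hN : 0 < N) :
    Continuous fun z : ℝ × ℝ => criticalModifiedGUEKernel Ψ τ α N z.1 z.2 := by
  obtain ⟨g, hg, hle⟩ := exists_profile_bound hΨ (mul_pos hτ (Real.rpow_pos_of_pos hN α)) N
  simp only [criticalModifiedGUEKernel_eq]
  refine continuous_const.mul (continuous_tsum (fun j => ?_) hg fun j z => hle _ _ j)
  have := continuous_hermiteFun j
  fun_prop

theorem continuous_sineFun (η : ℝ) : Continuous (sineFun η) := by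
  simp only [funext (sineFun_eq_sinc η)]
  have := Real.continuous_sinc
  fun_prop

theorem continuous_criticalSineMixtureKernel (Ψ : ℝ → ℝ) (τ α : ℝ) (ξ : ℝ → ℤ → ℝ) (N : ℝ) :
    Continuous fun z : ℝ × ℝ => criticalSineMixtureKernel Ψ τ α ξ N z.1 z.2 := by
  unfold criticalSineMixtureKernel sineMixtureKernel
  refine continuous_const.mul (continuous_finsetSum _ fun k _ => continuous_const.mul ?_)
  exact (continuous_sineFun _).comp (by fun_prop)

theorem hasCumulants_of_continuous {K : ℝ → ℝ → ℝ} (hK : Continuous fun z : ℝ × ℝ => K z.1 z.2) :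
    HasCumulants K := by
  intro f hf hfc n _ m
  have hcont : Continuous (traceIntegrand K f m) := by
    unfold traceIntegrand
    refine continuous_finsetProd _ fun i _ => ((hf.comp (continuous_apply i)).pow _).mul ?_
    have h : Continuous fun x : Fin m.length → ℝ => (x i, x (finRotate m.length i)) := by fun_prop
    exact hK.comp h
  refine hcont.integrable_of_hasCompactSupport ?_
  refine HasCompactSupport.intro (isCompact_univ_pi fun _ => hfc) (fun x hx => ?_)
  simp only [Set.mem_pi, Set.mem_univ, true_imp_iff, not_forall] at hx
  obtain ⟨i, hi⟩ := hx
  refine Finset.prod_eq_zero (Finset.mem_univ i) ?_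
  rw [image_eq_zero_of_notMem_tsupport hi, zero_pow (by
    have := m.one_le_blocksFun i; omega), zero_mul]

/-! ### Domination of the sine mixture by a Riesz kernel. -/

theorem abs_sineFun_le_inv {η u : ℝ} (hu : u ≠ 0) : |sineFun η u| ≤ |u|⁻¹ := by
  have hpi := Real.pi_gt_three
  rw [sineFun, if_neg hu, abs_div, abs_mul, abs_of_pos Real.pi_pos, ← one_div,
    div_le_div_iff₀ (by positivity) (by positivity)]
  have h1 := Real.abs_sin_le_one (2 * Real.pi * η * u)
  nlinarith [abs_nonneg u, abs_pos.2 hu]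

theorem abs_sineFun_le {η : ℝ} (hη : 0 ≤ η) (u : ℝ) : |sineFun η u| ≤ 2 * η := by
  rw [sineFun_eq_sinc, abs_mul, abs_of_nonneg (by positivity : 0 ≤ 2 * η)]
  exact mul_le_of_le_one_right (by positivity) (Real.abs_sinc_le_one _)

/-- Interpolation between the two bounds on the sine kernel. -/
theorem abs_sineFun_le_rpow {η M κ u : ℝ} (hη : 0 ≤ η) (hM : 2 * η ≤ M) (hM0 : 0 < M)
    (hκ : 0 ≤ κ) (hκ1 : κ ≤ 1) (hu : u ≠ 0) : |sineFun η u| ≤ M ^ κ * |u| ^ (κ - 1) := by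
  rcases (abs_nonneg (sineFun η u)).eq_or_lt with h | h
  · rw [← h]; positivity
  · calc |sineFun η u| = |sineFun η u| ^ κ * |sineFun η u| ^ (1 - κ) := by
          rw [← Real.rpow_add h]; simp
      _ ≤ M ^ κ * (|u|⁻¹) ^ (1 - κ) := by
          gcongr
          · exact (abs_sineFun_le hη u).trans hM
          · exact abs_sineFun_le_inv hu
      _ = _ := by
          rw [Real.inv_rpow (abs_nonneg u), ← Real.rpow_neg (abs_nonneg u), neg_sub]

/-- The weights are non-negative with sum at most 1, so the bound for one sine kernel passes to the
mixture. The singularity |x-y|^{κ-1} is integrable for κ > 0, at the price of only a small power of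
N. -/
theorem abs_criticalSineMixtureKernel_le {Ψ : ℝ → ℝ} (hΨ : IsExpShape Ψ) {α τ : ℝ} (hα0 : 0 < α)
    (hτ : 0 < τ) {ξ : ℝ → ℤ → ℝ} {N : ℝ} (hN : 1 ≤ N)
    (hξ : ∀ k : ℤ, IsMeanValuePoint Ψ τ α N k (ξ N k))
    (hBN : Real.log N ^ 2 * N ^ α + 1 ≤ N / 2) {κ : ℝ} (hκ : 0 ≤ κ) (hκ1 : κ ≤ 1) {x y : ℝ}
    (hxy : x ≠ y) :
    |criticalSineMixtureKernel Ψ τ α ξ N x y| ≤ (2 * N) ^ κ * |x - y| ^ (κ - 1) := by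
  have hN0 : 0 < N := by linarith
  have hσ : 0 < τ * N ^ α := mul_pos hτ (Real.rpow_pos_of_pos hN0 α)
  rw [criticalSineMixtureKernel_eq hN0 hξ]
  set B := ⌊Real.log N ^ 2 * N ^ α⌋₊ with hB
  have hB1 : (B : ℝ) ≤ Real.log N ^ 2 * N ^ α := Nat.floor_le (by positivity)
  have hanti := hΨ.toIsShape.antitone
  set D := (2 * N) ^ κ * |x - y| ^ (κ - 1) with hD
  have hD0 : 0 ≤ D := by positivity
  calc _ ≤ ∑ k ∈ Finset.Icc (-(B : ℤ)) B,
        (Ψ ((k : ℝ) / (τ * N ^ α)) - Ψ (((k : ℝ) + 1) / (τ * N ^ α))) * D := by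
        refine (Finset.abs_sum_le_sum_abs _ _).trans (Finset.sum_le_sum fun k hk => ?_)
        have h0 : 0 ≤ Ψ ((k : ℝ) / (τ * N ^ α)) - Ψ (((k : ℝ) + 1) / (τ * N ^ α)) :=
          sub_nonneg.2 (hanti (by gcongr; linarith))
        rw [abs_mul, abs_of_nonneg h0]
        refine mul_le_mul_of_nonneg_left ?_ h0
        refine abs_sineFun_le_rpow (by positivity) ?_ (by positivity) hκ hκ1 (sub_ne_zero.2 hxy)
        have h1 : N ^ (1 - α) ≤ N := by
          nth_rewrite 2 [← Real.rpow_one N]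
          exact Real.rpow_le_rpow_of_exponent_le hN (by linarith)
        have h2 : √(1 + (k : ℝ) / N) ≤ 2 := by
          rw [Real.sqrt_le_left (by norm_num)]
          have hk2 : (k : ℝ) ≤ B := by exact_mod_cast (Finset.mem_Icc.1 hk).2
          have : (k : ℝ) / N ≤ 1 := by rw [div_le_one hN0]; linarith
          linarith
        have h3 : N ^ (1 - α) * √(1 + (k : ℝ) / N) ≤ N * 2 := by gcongr
        linarith
    _ = (Ψ (-B / (τ * N ^ α)) - Ψ ((B + 1) / (τ * N ^ α))) * D := by
        rw [← Finset.sum_mul]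
        have := sum_Icc_int_sub (fun k : ℤ => Ψ ((k : ℝ) / (τ * N ^ α))) (a := -(B : ℤ)) (b := B)
          (by omega)
        push_cast at this
        rw [this]
    _ ≤ 1 * D := by
        gcongr
        have h1 := (hΨ.mem_Icc (-B / (τ * N ^ α))).2
        have h2 := (hΨ.mem_Icc ((B + 1) / (τ * N ^ α))).1
        linarith
    _ = D := one_mul D

/-! ### Traces of close kernels. -/

theorem measurable_kernel_coordinates {g : ℝ → ℝ → ENNReal}
    (hg : Measurable fun z : ℝ × ℝ => g z.1 z.2) {ℓ : ℕ} (i j : Fin ℓ) :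
    Measurable fun x : Fin ℓ → ℝ => g (x i) (x j) := by
  have h : Measurable fun x : Fin ℓ → ℝ => (x i, x j) := by fun_prop
  exact hg.comp h

/-- Integrating out an open chain of kernels, one variable at a time. -/
theorem lintegral_chain_le {g : ℝ → ℝ → ENNReal} (hg : Measurable fun z : ℝ × ℝ => g z.1 z.2)
    {c : ENNReal} (hc : ∀ x, ∫⁻ y, g x y ≤ c) (n : ℕ) {w : ℝ → ENNReal} (hw : Measurable w) :
    ∫⁻ x : Fin (n + 1) → ℝ, w (x 0) * ∏ j : Fin n, g (x j.castSucc) (x j.succ) ≤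
      c ^ n * ∫⁻ t, w t := by
  induction n generalizing w with
  | zero =>
    have h := (volume_preserving_funUnique (Fin 1) ℝ).lintegral_comp hw
    simp only [Finset.univ_eq_empty, Finset.prod_empty, mul_one, pow_zero, one_mul]
    exact h.le
  | succ n ih =>
    have hmp := (volume_preserving_piFinSuccAbove (fun _ : Fin (n + 2) => ℝ) 0).symm
    have hF : Measurable fun x : Fin (n + 2) → ℝ =>
        w (x 0) * ∏ j : Fin (n + 1), g (x j.castSucc) (x j.succ) := by
      refine (hw.comp (measurable_pi_apply 0)).mul (Finset.measurable_prod _ fun j _ => ?_)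
      exact measurable_kernel_coordinates hg _ _
    have hwg : Measurable fun z : ℝ × ℝ => w z.1 * g z.1 z.2 := (hw.comp measurable_fst).mul hg
    have hP : Measurable fun z : Fin (n + 1) → ℝ => ∏ j : Fin n, g (z j.castSucc) (z j.succ) :=
      Finset.measurable_prod _ fun j _ =>
        measurable_kernel_coordinates hg _ _
    rw [← hmp.lintegral_comp hF]
    have e : ∀ z : ℝ × (Fin (n + 1) → ℝ),
        (fun x : Fin (n + 2) → ℝ => w (x 0) * ∏ j : Fin (n + 1), g (x j.castSucc) (x j.succ))
          ((MeasurableEquiv.piFinSuccAbove (fun _ : Fin (n + 2) => ℝ) 0).symm z) =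
        w z.1 * g z.1 (z.2 0) * ∏ j : Fin n, g (z.2 j.castSucc) (z.2 j.succ) := by
      intro z
      simp only [MeasurableEquiv.piFinSuccAbove_symm_apply, Fin.insertNthEquiv_apply,
        Fin.insertNth_zero', Fin.prod_univ_succ, Fin.cons_zero, Fin.castSucc_zero, Fin.cons_succ,
        ← Fin.succ_castSucc, mul_assoc]
    simp only [e]
    rw [Measure.volume_eq_prod, lintegral_prod_symm]
    swap
    · refine Measurable.aemeasurable (Measurable.mul ?_ (hP.comp measurable_snd))
      exact hwg.comp (measurable_fst.prodMk ((measurable_pi_apply 0).comp measurable_snd))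
    have e2 : ∀ y : Fin (n + 1) → ℝ,
        ∫⁻ t, w t * g t (y 0) * ∏ j : Fin n, g (y j.castSucc) (y j.succ) =
          (fun s => ∫⁻ t, w t * g t s) (y 0) * ∏ j : Fin n, g (y j.castSucc) (y j.succ) := by
      intro y
      rw [lintegral_mul_const]
      exact hwg.comp (measurable_id.prodMk measurable_const)
    simp only [e2]
    -- Integrating out the first variable leaves a shorter chain whose new weight has, by Tonelli,
    -- mass at most c times that of the old one.
    refine (ih (w := fun s => ∫⁻ t, w t * g t s)
      (Measurable.lintegral_prod_left (f := fun t s => w t * g t s) hwg)).trans ?_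
    rw [pow_succ, mul_assoc]
    gcongr
    rw [lintegral_lintegral_swap]
    swap
    · exact (hwg.comp measurable_swap).aemeasurable
    rw [← lintegral_const_mul _ hw]
    refine lintegral_mono fun t => ?_
    have hgt : Measurable (g t) :=
      hg.comp ((measurable_const (a := t)).prodMk measurable_id)
    rw [lintegral_const_mul _ hgt, mul_comm]
    gcongr
    exact hc t

/-- Opening a cyclic chain of kernels at one of its links. -/
theorem lintegral_cycle_erase_le {g : ℝ → ℝ → ENNReal}
    (hg : Measurable fun z : ℝ × ℝ => g z.1 z.2) {c : ENNReal} (hc : ∀ x, ∫⁻ y, g x y ≤ c)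
    {ℓ : ℕ} (i : Fin ℓ) {w : ℝ → ENNReal} (hw : Measurable w) :
    ∫⁻ x : Fin ℓ → ℝ, w (x (finRotate ℓ i)) *
      ∏ j ∈ Finset.univ.erase i, g (x j) (x (finRotate ℓ j)) ≤ c ^ (ℓ - 1) * ∫⁻ t, w t := by
  obtain _ | n := ℓ
  · exact i.elim0
  · refine le_trans (le_of_eq ?_) (lintegral_chain_le hg hc n hw)
    -- The relabelling j ↦ j + i + 1 sends 0 to i + 1 and the last index to i, so the missing link
    -- becomes the gap between the end and the start of an open chain.
    have hmp := volume_measurePreserving_piCongrLeft (fun _ : Fin (n + 1) => ℝ)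
      (Equiv.addRight (i + 1))
    set e : Fin (n + 1) ≃ Fin (n + 1) := Equiv.addRight (i + 1) with he
    have hF : Measurable fun x : Fin (n + 1) → ℝ => w (x (finRotate (n + 1) i)) *
        ∏ j ∈ Finset.univ.erase i, g (x j) (x (finRotate (n + 1) j)) := by
      refine (hw.comp (measurable_pi_apply _)).mul (Finset.measurable_prod _ fun j _ => ?_)
      exact measurable_kernel_coordinates hg _ _
    rw [← hmp.lintegral_comp hF]
    refine lintegral_congr fun x => ?_
    have hT : ∀ j, MeasurableEquiv.piCongrLeft (fun _ : Fin (n + 1) => ℝ) e x (e j) = x j := by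
      intro j
      rw [MeasurableEquiv.coe_piCongrLeft]
      exact Equiv.piCongrLeft_apply_apply (P := fun _ : Fin (n + 1) => ℝ) e x j
    generalize MeasurableEquiv.piCongrLeft (fun _ : Fin (n + 1) => ℝ) e x = y at hT
    have h0 : finRotate (n + 1) i = e 0 := by simp [he]
    rw [h0, hT]
    congr 1
    have h1 : ∏ j ∈ Finset.univ.erase i, g (y j) (y (finRotate (n + 1) j)) =
        ∏ j, if j = i then 1 else g (y j) (y (finRotate (n + 1) j)) := by
      rw [← Finset.mul_prod_erase _ _ (Finset.mem_univ i), if_pos rfl, one_mul]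
      exact Finset.prod_congr rfl fun j hj => by rw [if_neg (Finset.ne_of_mem_erase hj)]
    have h2 : e (Fin.last n) = i := by
      simp only [he, Equiv.coe_addRight]
      rw [add_comm i 1, ← add_assoc, Fin.last_add_one, zero_add]
    rw [h1, ← e.prod_comp, Fin.prod_univ_castSucc, if_pos h2, mul_one]
    refine Finset.prod_congr rfl fun j _ => ?_
    have h3 : e j.castSucc ≠ i := by
      rw [← h2, e.injective.ne_iff]; exact (Fin.castSucc_lt_last j).ne
    have h4 : finRotate (n + 1) (e j.castSucc) = e j.succ := by
      rw [finRotate_apply, ← Fin.coeSucc_eq_succ]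
      simp only [he, Equiv.coe_addRight]
      abel
    rw [if_neg h3, h4, hT, hT]

/-- Telescoping: the factors are exchanged one at a time, and every mixed product is dominated by G.
-/
theorem enorm_prod_sub_prod_le {ι : Type*} [DecidableEq ι] (s : Finset ι) (a b : ι → ℝ)
    {G d : ι → ENNReal} (ha : ∀ i ∈ s, ‖a i‖ₑ ≤ G i) (hb : ∀ i ∈ s, ‖b i‖ₑ ≤ G i)
    (hd : ∀ i ∈ s, ‖a i - b i‖ₑ ≤ d i) :
    ‖∏ i ∈ s, a i - ∏ i ∈ s, b i‖ₑ ≤ ∑ i ∈ s, d i * ∏ j ∈ s.erase i, G j := by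
  induction s using Finset.induction_on with
  | empty => simp
  | insert k s hk ih =>
    rw [Finset.forall_mem_insert] at ha hb hd
    rw [Finset.prod_insert hk, Finset.prod_insert hk, Finset.sum_insert hk,
      Finset.erase_insert hk]
    have e : a k * ∏ i ∈ s, a i - b k * ∏ i ∈ s, b i =
        (a k - b k) * ∏ i ∈ s, a i + b k * (∏ i ∈ s, a i - ∏ i ∈ s, b i) := by ring
    rw [e]
    refine (enorm_add_le _ _).trans (add_le_add ?_ ?_)
    · rw [enorm_mul]
      have : ‖∏ i ∈ s, a i‖ₑ = ∏ i ∈ s, ‖a i‖ₑ := by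
        simp [enorm_eq_nnnorm, nnnorm_prod]
      rw [this]
      exact mul_le_mul' hd.1 (Finset.prod_le_prod' ha.2)
    · rw [enorm_mul]
      refine (mul_le_mul' hb.1 (ih ha.2 hb.2 hd.2)).trans ?_
      rw [Finset.mul_sum]
      refine Finset.sum_le_sum fun i hi => ?_
      have hik : k ≠ i := fun h => hk (h ▸ hi)
      rw [Finset.erase_insert_of_ne hik, Finset.prod_insert (fun h => hk (Finset.mem_of_mem_erase h))]
      rw [mul_left_comm]

/-- Traces of two uniformly close kernels are close, if both are dominated by a kernel with bounded
row integrals. -/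
theorem enorm_trace_sub_le {K L : ℝ → ℝ → ℝ} (hK : HasCumulants K) (hL : HasCumulants L)
    {f : ℝ → ℝ} (hf : Continuous f) (hfc : HasCompactSupport f) {A F : ℝ}
    (hA : ∀ x, A < |x| → f x = 0) (hF : ∀ x, |f x| ≤ F) {g : ℝ → ℝ → ENNReal}
    (hg : Measurable fun z : ℝ × ℝ => g z.1 z.2) {c : ENNReal} (hc : ∀ x, ∫⁻ y, g x y ≤ c)
    (hKg : ∀ x y, |x| ≤ A → |y| ≤ A → ‖K x y‖ₑ ≤ g x y)
    (hLg : ∀ x y, |x| ≤ A → |y| ≤ A → ‖L x y‖ₑ ≤ g x y) {ε : ENNReal}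
    (hε : ∀ x y, |x| ≤ A → |y| ≤ A → ‖K x y - L x y‖ₑ ≤ ε) {n : ℕ} (hn : 1 ≤ n)
    (m : Composition n) :
    ‖(∫ x, traceIntegrand K f m x) - ∫ x, traceIntegrand L f m x‖ₑ ≤
      (∏ i, ENNReal.ofReal F ^ m.blocksFun i) *
        (m.length * (ε * (c ^ (m.length - 1) * ENNReal.ofReal (2 * A)))) := by
  rw [← integral_sub (hK f hf hfc n hn m) (hL f hf hfc n hn m)]
  refine (enorm_integral_le_lintegral_enorm _).trans ?_
  set w : ℝ → ENNReal := Set.indicator (Set.Icc (-A) A) 1 with hw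
  have hwm : Measurable w := measurable_one.indicator measurableSet_Icc
  have hwi : ∫⁻ t, w t = ENNReal.ofReal (2 * A) := by
    rw [hw, lintegral_indicator_one measurableSet_Icc, Real.volume_Icc]
    congr 1; ring
  set P : ENNReal := ∏ i, ENNReal.ofReal F ^ m.blocksFun i with hP
  have hpt : ∀ x : Fin m.length → ℝ, ‖traceIntegrand K f m x - traceIntegrand L f m x‖ₑ ≤
      P * ∑ i, ε * (w (x (finRotate m.length i)) *
        ∏ j ∈ Finset.univ.erase i, g (x j) (x (finRotate m.length j))) := by
    intro x
    by_cases hx : ∀ i, |x i| ≤ A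
    · unfold traceIntegrand
      rw [Finset.prod_mul_distrib, Finset.prod_mul_distrib, ← mul_sub, enorm_mul]
      have h1 : ‖∏ i, f (x i) ^ m.blocksFun i‖ₑ ≤ P := by
        have : ‖∏ i, f (x i) ^ m.blocksFun i‖ₑ = ∏ i, ‖f (x i)‖ₑ ^ m.blocksFun i := by
          simp [enorm_eq_nnnorm, nnnorm_prod]
        rw [this, hP]
        refine Finset.prod_le_prod' fun i _ => pow_le_pow_left' ?_ _
        rw [Real.enorm_eq_ofReal_abs]
        exact ENNReal.ofReal_le_ofReal (hF _)
      refine mul_le_mul' h1 ((enorm_prod_sub_prod_le _ _ _ (fun i _ => hKg _ _ (hx _) (hx _))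
        (fun i _ => hLg _ _ (hx _) (hx _)) (fun i _ => hε _ _ (hx _) (hx _))).trans_eq ?_)
      refine Finset.sum_congr rfl fun i _ => ?_
      rw [hw, Set.indicator_of_mem (show x (finRotate m.length i) ∈ Set.Icc (-A) A from
        abs_le.1 (hx _)), Pi.one_apply, one_mul]
    · push Not at hx
      obtain ⟨i, hi⟩ := hx
      have h0 : ∀ K : ℝ → ℝ → ℝ, traceIntegrand K f m x = 0 := fun K => by
        refine Finset.prod_eq_zero (Finset.mem_univ i) ?_
        rw [hA _ hi, zero_pow (by have := m.one_le_blocksFun i; omega), zero_mul]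
      simp [h0]
  refine (lintegral_mono hpt).trans ?_
  have hterm : ∀ i : Fin m.length, Measurable fun x : Fin m.length → ℝ =>
      w (x (finRotate m.length i)) *
        ∏ j ∈ Finset.univ.erase i, g (x j) (x (finRotate m.length j)) := fun i =>
    (hwm.comp (measurable_pi_apply _)).mul
      (Finset.measurable_prod _ fun j _ => measurable_kernel_coordinates hg _ _)
  rw [lintegral_const_mul _ (Finset.measurable_sum _ fun i _ => (hterm i).const_mul ε),
    lintegral_finsetSum _ fun i _ => (hterm i).const_mul ε]
  refine mul_le_mul' le_rfl ?_
  calc _ ≤ ∑ _i : Fin m.length, ε * (c ^ (m.length - 1) * ENNReal.ofReal (2 * A)) := by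
        refine Finset.sum_le_sum fun i _ => ?_
        rw [lintegral_const_mul _ (hterm i), ← hwi]
        exact mul_le_mul' le_rfl (lintegral_cycle_erase_le hg hc i hwm)
    _ = _ := by simp

/-! ### The dominating kernel and the limit. -/

/-- A translation invariant dominating kernel, infinite on the diagonal. -/
noncomputable def rieszKernel (A M κ x y : ℝ) : ENNReal :=
  -- At u = 0 the real power `|u| ^ (κ - 1)` is 0 when κ < 1, so the formula need not dominate
  -- there; ⊤ does, and a single point does not affect a row integral. The summand 1 leaves room for
  -- the difference of the two kernels.
  if x - y = 0 then ⊤ else Set.indicator (Set.Icc (-(2 * A)) (2 * A))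
    (fun u => ENNReal.ofReal (M * |u| ^ (κ - 1) + 1)) (x - y)

theorem measurable_rieszKernel (A M κ : ℝ) :
    Measurable fun z : ℝ × ℝ => rieszKernel A M κ z.1 z.2 := by
  unfold rieszKernel
  refine Measurable.ite ((measurable_fst.sub measurable_snd) (measurableSet_singleton 0))
    measurable_const ?_
  refine Measurable.comp (Measurable.indicator ?_ measurableSet_Icc)
    (measurable_fst.sub measurable_snd)
  fun_prop

theorem exists_lintegral_rieszKernel_le {A κ : ℝ} (hA : 0 ≤ A) (hκ : 0 < κ) :
    ∃ J : ℝ, 0 ≤ J ∧ ∀ M x : ℝ, 1 ≤ M →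
      ∫⁻ y, rieszKernel A M κ x y ≤ ENNReal.ofReal (J * M) := by
  have hint : IntegrableOn (fun u : ℝ => |u| ^ (κ - 1) + 1) (Set.Icc (-(2 * A)) (2 * A)) := by
    rw [integrableOn_Icc_iff_integrableOn_Ioc, ← intervalIntegrable_iff_integrableOn_Ioc_of_le
      (by linarith)]
    have h1 : IntervalIntegrable (fun u : ℝ => |u| ^ (κ - 1)) volume 0 (2 * A) := by
      refine (intervalIntegral.intervalIntegrable_rpow' (a := 0) (b := 2 * A)
        (by linarith : -1 < κ - 1)).congr fun u hu => ?_
      rw [Set.uIoc_of_le (by linarith)] at hu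
      simp only [abs_of_pos hu.1]
    have h2 : IntervalIntegrable (fun u : ℝ => |u| ^ (κ - 1)) volume (-(2 * A)) 0 := by
      have := h1.comp_sub_left 0
      simpa using this.symm
    exact (h2.trans h1).add intervalIntegrable_const
  refine ⟨∫ u in Set.Icc (-(2 * A)) (2 * A), (|u| ^ (κ - 1) + 1),
    setIntegral_nonneg measurableSet_Icc fun u _ => by positivity, fun M x hM => ?_⟩
  set h : ℝ → ENNReal := Set.indicator (Set.Icc (-(2 * A)) (2 * A))
    (fun u => ENNReal.ofReal (M * |u| ^ (κ - 1) + 1)) with hh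
  calc ∫⁻ y, rieszKernel A M κ x y = ∫⁻ y, h (x - y) := by
        refine lintegral_congr_ae ?_
        have : ∀ᵐ y : ℝ, y ≠ x := by simp [ae_iff]
        filter_upwards [this] with y hy
        rw [rieszKernel, if_neg (sub_ne_zero.2 hy.symm)]
    _ = ∫⁻ u, h u := lintegral_sub_left_eq_self h x
    _ = ∫⁻ u in Set.Icc (-(2 * A)) (2 * A), ENNReal.ofReal (M * |u| ^ (κ - 1) + 1) := by
        rw [hh, lintegral_indicator measurableSet_Icc]
    _ ≤ ∫⁻ u in Set.Icc (-(2 * A)) (2 * A), ENNReal.ofReal ((|u| ^ (κ - 1) + 1) * M) := by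
        refine lintegral_mono fun u => ENNReal.ofReal_le_ofReal ?_
        nlinarith [Real.rpow_nonneg (abs_nonneg u) (κ - 1)]
    _ = _ := by
        rw [← ofReal_integral_eq_lintegral_ofReal (hint.mul_const M)
          (Eventually.of_forall fun u => by positivity), integral_mul_const]

theorem tendsto_trace_sub {Ψ : ℝ → ℝ} (hΨ : IsExpShape Ψ) {α τ : ℝ} (hα : 1 / 3 < α)
    (hα1 : α < 1) (hτ : 0 < τ) {ξ : ℝ → ℤ → ℝ}
    (hξ : ∀ N : ℝ, 0 < N → ∀ k : ℤ, IsMeanValuePoint Ψ τ α N k (ξ N k)) {f : ℝ → ℝ}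
    (hf : Continuous f) (hfc : HasCompactSupport f) {n : ℕ} (hn : 1 ≤ n) (m : Composition n) :
    Tendsto (fun N => (∫ x, traceIntegrand (criticalModifiedGUEKernel Ψ τ α N) f m x) -
      ∫ x, traceIntegrand (criticalSineMixtureKernel Ψ τ α ξ N) f m x) atTop (𝓝 0) := by
  have hα0 : 0 < α := by linarith
  set δ := min (3 * α - 1) α with hδ
  have hδ0 : 0 < δ := lt_min (by linarith) hα0
  have hδα : δ ≤ α := min_le_right _ _
  obtain ⟨A, hA0, hA⟩ : ∃ A : ℝ, 0 ≤ A ∧ ∀ x, A < |x| → f x = 0 := by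
    obtain ⟨A, hA⟩ := hfc.isCompact.isBounded.exists_norm_le
    refine ⟨max A 0, le_max_right _ _, fun x hx => image_eq_zero_of_notMem_tsupport fun hx' => ?_⟩
    exact absurd (hA x hx') (not_le.2 ((le_max_left _ _).trans_lt hx))
  obtain ⟨F, hF⟩ := hfc.exists_bound_of_continuous hf
  have hF0 : 0 ≤ F := (norm_nonneg _).trans (hF 0)
  obtain ⟨C, hC0, hC⟩ := eventually_critical_kernels_sub_le hΨ hα1 hα0 hτ
    (min_le_left (3 * α - 1) α) (min_le_right (3 * α - 1) α) hξ A
  rw [← hδ] at hC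
  have hℓ1 : 1 ≤ m.length := Nat.one_le_iff_ne_zero.2 fun h => by
    rw [Composition.length_eq_zero] at h; omega
  have hℓ1' : (1 : ℝ) ≤ m.length := by exact_mod_cast hℓ1
  -- The ℓ - 1 row integrals then cost at most N^{δ/2} in total, against the gain N^{-δ} from the
  -- uniform estimate.
  set κ := δ / (2 * m.length) with hκ
  have hκ0 : 0 < κ := by positivity
  have hκ1 : κ ≤ 1 := by
    rw [hκ, div_le_one (by positivity)]; linarith
  have hκℓ : κ * (m.length - 1 : ℕ) ≤ δ / 2 := by
    have : ((m.length - 1 : ℕ) : ℝ) ≤ m.length := by exact_mod_cast Nat.sub_le _ _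
    calc κ * (m.length - 1 : ℕ) ≤ κ * m.length := by gcongr
      _ = δ / 2 := by rw [hκ]; field_simp
  obtain ⟨J, hJ0, hJ⟩ := exists_lintegral_rieszKernel_le hA0 hκ0
  set D := (∏ i, F ^ m.blocksFun i) * (m.length * (C * ((J * 2 ^ κ) ^ (m.length - 1) * (2 * A))))
    with hD
  have hdecay : Tendsto (fun N : ℝ => C * N ^ (-δ)) atTop (𝓝 0) := by
    simpa using (tendsto_rpow_neg_atTop hδ0).const_mul C
  have hdecay' : Tendsto (fun N : ℝ => D * N ^ (-(δ / 2))) atTop (𝓝 0) := by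
    simpa using (tendsto_rpow_neg_atTop (half_pos hδ0)).const_mul D
  refine squeeze_zero_norm' ?_ hdecay'
  filter_upwards [hC, hdecay.eventually_le_const one_pos, eventually_ge_atTop 1,
    eventually_log_sq_mul_rpow_le hα1] with N hCN hCN1 hN hBN
  have hN0 : 0 < N := by linarith
  have hM : 1 ≤ (2 * N) ^ κ := Real.one_le_rpow (by linarith) hκ0.le
  have hLb : ∀ x y, x ≠ y → |criticalSineMixtureKernel Ψ τ α ξ N x y| ≤ _ := fun x y hxy =>
    abs_criticalSineMixtureKernel_le hΨ hα0 hτ hN (hξ N hN0) hBN hκ0.le hκ1 hxy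
  have hdom : ∀ (Q : ℝ → ℝ → ℝ), (∀ x y, |x| ≤ A → |y| ≤ A → x ≠ y →
      |Q x y| ≤ (2 * N) ^ κ * |x - y| ^ (κ - 1) + 1) →
      ∀ x y, |x| ≤ A → |y| ≤ A → ‖Q x y‖ₑ ≤ rieszKernel A ((2 * N) ^ κ) κ x y := by
    intro Q hQ x y hx hy
    unfold rieszKernel
    split_ifs with hxy
    · exact le_top
    · have hmem : x - y ∈ Set.Icc (-(2 * A)) (2 * A) := by
        rw [abs_le] at hx hy
        constructor <;> linarith [hx.1, hx.2, hy.1, hy.2]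
      rw [Set.indicator_of_mem hmem, Real.enorm_eq_ofReal_abs]
      exact ENNReal.ofReal_le_ofReal (hQ x y hx hy (sub_ne_zero.1 hxy))
  have hmain := enorm_trace_sub_le
    (hasCumulants_of_continuous (continuous_criticalModifiedGUEKernel hΨ (α := α) hτ hN0))
    (hasCumulants_of_continuous (continuous_criticalSineMixtureKernel Ψ τ α ξ N)) hf hfc hA hF
    (measurable_rieszKernel A ((2 * N) ^ κ) κ) (fun x => hJ _ x hM)
    -- The modified kernel inherits the bound of the sine mixture, since for large N the two differ
    -- by at most 1 on the support.
    (hdom _ fun x y hx hy hxy => by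
      have h1 := hCN x y hx hy
      have h2 := hLb x y hxy
      have h3 := abs_add_le (criticalModifiedGUEKernel Ψ τ α N x y -
        criticalSineMixtureKernel Ψ τ α ξ N x y) (criticalSineMixtureKernel Ψ τ α ξ N x y)
      rw [sub_add_cancel] at h3
      linarith)
    (hdom _ fun x y _ _ hxy => (hLb x y hxy).trans (by linarith))
    (ε := ENNReal.ofReal (C * N ^ (-δ)))
    (fun x y hx hy => by
      rw [Real.enorm_eq_ofReal_abs]
      exact ENNReal.ofReal_le_ofReal (hCN x y hx hy)) hn m
  rw [Real.norm_eq_abs]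
  have hprod : (∏ i, ENNReal.ofReal F ^ m.blocksFun i) =
      ENNReal.ofReal (∏ i, F ^ m.blocksFun i) := by
    rw [ENNReal.ofReal_prod_of_nonneg fun i _ => by positivity]
    simp_rw [ENNReal.ofReal_pow hF0]
  have hJM : 0 ≤ J * (2 * N) ^ κ := by positivity
  have hCNn : 0 ≤ C * N ^ (-δ) := by positivity
  have hPn : 0 ≤ ∏ i, F ^ m.blocksFun i := Finset.prod_nonneg fun i _ => by positivity
  rw [Real.enorm_eq_ofReal_abs, hprod, ← ENNReal.ofReal_pow hJM,
    ← ENNReal.ofReal_mul (by positivity), ← ENNReal.ofReal_mul hCNn,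
    ← ENNReal.ofReal_natCast, ← ENNReal.ofReal_mul (by positivity),
    ← ENNReal.ofReal_mul hPn, ENNReal.ofReal_le_ofReal_iff (by positivity)] at hmain
  refine hmain.trans ?_
  have e1 : (J * (2 * N) ^ κ) ^ (m.length - 1) =
      (J * 2 ^ κ) ^ (m.length - 1) * N ^ (κ * (m.length - 1 : ℕ)) := by
    rw [Real.mul_rpow zero_le_two hN0.le, ← mul_assoc, mul_pow, Real.rpow_mul hN0.le,
      Real.rpow_natCast]
  have e2 : N ^ (-δ) * N ^ (κ * (m.length - 1 : ℕ)) ≤ N ^ (-(δ / 2)) := by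
    rw [← Real.rpow_add hN0]
    exact Real.rpow_le_rpow_of_exponent_le hN (by linarith)
  rw [e1]
  calc _ = D * (N ^ (-δ) * N ^ (κ * (m.length - 1 : ℕ))) := by rw [hD]; ring
    _ ≤ D * N ^ (-(δ / 2)) := by gcongr

theorem mainTheorem6 (Ψ : ℝ → ℝ) (hΨ : IsExpShape Ψ) (α τ : ℝ) (hα : 1 / 3 < α) (hα1 : α < 1)
    (hτ : 0 < τ) (ξ : ℝ → ℤ → ℝ)
    (hξ : ∀ N : ℝ, 0 < N → ∀ k : ℤ, IsMeanValuePoint Ψ τ α N k (ξ N k)) :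
    (∀ N : ℝ, 0 < N →
      (∀ x y : ℝ, Summable (modifiedGUETerm Ψ τ α N x y)) ∧
      HasCumulants (criticalModifiedGUEKernel Ψ τ α N) ∧
      HasCumulants (criticalSineMixtureKernel Ψ τ α ξ N)) ∧
    AsymptoticallyEquivalent
      (criticalModifiedGUEKernel Ψ τ α)
      (criticalSineMixtureKernel Ψ τ α ξ) := by
  refine ⟨fun N hN => ⟨summable_modifiedGUETerm hΨ hτ hN,
    hasCumulants_of_continuous (continuous_criticalModifiedGUEKernel hΨ hτ hN),
    hasCumulants_of_continuous (continuous_criticalSineMixtureKernel Ψ τ α ξ N)⟩, ?_⟩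
  intro f hf hfc n hn
  unfold kernelCumulant
  simp only [← Finset.sum_sub_distrib, ← mul_sub]
  rw [show (0 : ℝ) = ∑ m : Composition n, (-1) ^ (m.length + 1) / (m.length : ℝ) *
      ((n.factorial : ℝ) / ∏ i, ((m.blocksFun i).factorial : ℝ)) * 0 by simp]
  exact tendsto_finsetSum _ fun m _ =>
    (tendsto_trace_sub hΨ hα hα1 hτ hξ hf hfc hn m).const_mul _
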